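/- Let $k\in\{1,2,3\}$ and let $n\ge 1$ be an integer. Let $C\subset\mathbb{R}^k$ be a compact convex set and let $f:C\to\mathbb{R}$ be bounded and Lebesgue measurable. For $z\in C$ put $$f^{\ast n}(z)=\sup\left\{\frac{f(x_1)+\dots+f(x_n)}{n} : x_1,\dots,x_n\in C,\ \frac{x_1+\dots+x_n}{n}=z\right\},$$ and let $\operatorname{co}(f)(z)=\inf\{g(z) : g:C\to\mathbb{R}\text{ concave},\ g\ge f\text{ on }C\}$. For a bounded function $g$ on $C$, let $\int_C g(x)\,dx$ denote the upper Lebesgue integral, that is, the infimum of the Lebesgue integrals over $C$ of the integrable functions $h\ge g$ on $C$ (it is the usual integral when $g$ is measurable). Then $$\int_C f^{\ast n}(x)-f(x)\,dx\ \ge\ c_{k,n}\int_C \operatorname{co}(f)(x)-f(x)\,dx,$$ where $$c_{1,n}=\frac{n-1}{n},\qquad c_{2,n}=\frac{(2n-1)(n-1)}{2n^2},\qquad c_{3,n}=\frac{(n-1)^2}{n^2}.$$ These constants are sharp: if $C=T\subset\mathbb{R}^k$ is any nondegenerate $k$-dimensional simplex and $f$ is the indicator function of the set of vertices of $T$, then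 equality holds and $\int_T \operatorname{co}(f)(x)-f(x)\,dx>0$. -/

import Mathlib

open MeasureTheory

noncomputable section

namespace SupConvolution

/-- `k`-dimensional Euclidean space; its `volume` is Lebesgue measure. -/
abbrev Space (k : ℕ) : Type := EuclideanSpace ℝ (Fin k)

/-- The sup-convolution `f₁ ∗ ⋯ ∗ fₙ` over the domain `C`: at `z`, the supremum of the averages
`(f₁ x₁ + ⋯ + fₙ xₙ) / n` over all `x₁, …, xₙ ∈ C` with `(x₁ + ⋯ + xₙ) / n = z`.
Only the values of the `fᵢ` on `C` matter. For `n ≥ 1`, `fᵢ` bounded above on `C` and `z ∈ C`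
with `C` convex, the supremum is over a nonempty set that is bounded above. -/
def supConv {k : ℕ} (C : Set (Space k)) {n : ℕ} (f : Fin n → Space k → ℝ) (z : Space k) : ℝ :=
  sSup {y : ℝ | ∃ x : Fin n → Space k, (∀ i, x i ∈ C) ∧
    (n : ℝ)⁻¹ • ∑ i, x i = z ∧ y = (∑ i, f i (x i)) / n}

/-- The `n`-fold sup-convolution `f ∗ ⋯ ∗ f` of one function over `C`. -/
def supConvPow {k : ℕ} (C : Set (Space k)) (n : ℕ) (f : Space k → ℝ) : Space k → ℝ :=
  supConv C (fun _ : Fin n => f)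

/-- The upper convex hull `co(f)` of `f` on `C`: the pointwise infimum of all concave functions
on `C` that are at least `f` on `C`. -/
def concaveHull {k : ℕ} (C : Set (Space k)) (f : Space k → ℝ) (z : Space k) : ℝ :=
  sInf {y : ℝ | ∃ g : Space k → ℝ, ConcaveOn ℝ C g ∧ (∀ x ∈ C, f x ≤ g x) ∧ y = g z}

/-- The upper Lebesgue integral of a (not necessarily measurable) function `g` over `C`: the
infimum of the integrals of the integrable functions that are at least `g` on `C`. It is used
for functions that are bounded on a set `C` of finite measure. -/
def upperIntegral {k : ℕ} (C : Set (Space k)) (g : Space k → ℝ) : ℝ :=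
  sInf {I : ℝ | ∃ h : Space k → ℝ, IntegrableOn h C volume ∧ (∀ x ∈ C, g x ≤ h x) ∧
    I = ∫ x in C, h x}

/-- The constants `c_{k,n}` for `k = 1, 2, 3` (the value for other `k` is irrelevant). -/
def sharpConst (k n : ℕ) : ℝ :=
  match k with
  | 1 => ((n : ℝ) - 1) / n
  | 2 => (2 * (n : ℝ) - 1) * ((n : ℝ) - 1) / (2 * (n : ℝ) ^ 2)
  | 3 => ((n : ℝ) - 1) ^ 2 / (n : ℝ) ^ 2
  | _ => 0

end SupConvolution

end

open scoped Pointwise Topology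

namespace SupConvolution

/-! An upper integral is an infimum over integrable majorants, so it suffices to bound `∫ H` from
below for every integrable `H` with `(∑ i, f (x i)) / n ≤ H` at the average of the `x i`. No
measurability of the sup-convolution is needed.

The core case is a simplex. Let `L` interpolate affinely heights not exceeding `f` at the vertices,
and put `F = L - min f L` and `G = L - H`. Then `F ≥ 0` vanishes at the vertices, and `G` at an
average is at most the average of `F`. The claim becomes `∫ G ≤ (1 - c) ∫ F`
(`solidSimplex_inequality`). Dilate the standard simplex by `n` and split each point into integer
and fractional parts: the pieces are translates `m + slab k j` with `j + ∑ m ≤ n`. Such an `m` is a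
sum of `n - j` vertices, where `F` is zero, so `n G((m + r) / n)` is at most the sum of `F` over any
`j` points of the simplex with sum `r`. If these points are chosen as affine functions of `r` whose
images cover the simplex evenly on average, integration gives the factor `j * A`, with `A` the
volume of the slab in units of the simplex (`SlabBound`). Level `1` needs no splitting, and level
`k` uses cyclic shifts of barycentric coordinates. For `k ≤ 3` the only other slab is the octahedron
`k = 3`, `j = 2`, which is cut into octants (`slabBound_octahedron`). Summing over the pieces gives
`1 - c` (`sum_card_corners_mul`).

For a general domain, replace `C` by finitely many of its points. Generic heights slightly below `f`
triangulate their hull so that on every cell the interpolation is the concave envelope of the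
heights (`exists_triangulation`). The simplex case on each cell, summed, bounds `∫ H` in terms of
the envelope over the finite set (`approximate_lower_bound`). Finite sets exist whose envelopes
converge to that of `f` on the interior of `C`, and dominated convergence finishes
(`integral_lower_bound`).

For sharpness, if `n z` lies in a piece of level `j`, then at least `j` of any `n` points of the
simplex with average `z` are not vertices. Hence the sup-convolution of the vertex indicator is at
most `(n - j) / n` there, and the same count of pieces integrates this bound to `c` times the
volume. -/

/-! ### Decomposition of a dilated simplex into translated slabs of the unit cube -/

/-- The standard simplex in `ℝ^k`, dilated by `s`. -/
def solidSimplex (k : ℕ) (s : ℝ) : Set (Fin k → ℝ) := {t | (∀ i, 0 ≤ t i) ∧ ∑ i, t i ≤ s}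

/-- The part of the half-open unit cube where the coordinate sum lies in `(j - 1, j]`. -/
def slab (k j : ℕ) : Set (Fin k → ℝ) :=
  {r | (∀ i, 0 ≤ r i ∧ r i < 1) ∧ (j : ℝ) - 1 < ∑ i, r i ∧ ∑ i, r i ≤ j}

/-- A tuple of natural numbers as a real vector. -/
def natVec {k : ℕ} (m : Fin k → ℕ) : Fin k → ℝ := fun i => (m i : ℝ)

/-- The corners of the translated slabs of level `j` in the simplex dilated by `n`. -/
def corners (k n j : ℕ) : Finset (Fin k → ℕ) :=
  (Fintype.piFinset fun _ : Fin k => Finset.range (n + 1)).filter fun m => j + ∑ i, m i ≤ n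

theorem mem_corners {k n j : ℕ} {m : Fin k → ℕ} : m ∈ corners k n j ↔ j + ∑ i, m i ≤ n := by
  unfold corners
  simp only [Finset.mem_filter, Fintype.mem_piFinset, Finset.mem_range, and_iff_right_iff_imp]
  intro h i
  have := Finset.single_le_sum (f := m) (fun i _ => Nat.zero_le _) (Finset.mem_univ i)
  omega

theorem measurableSet_solidSimplex (k : ℕ) (s : ℝ) : MeasurableSet (solidSimplex k s) := by
  unfold solidSimplex
  measurability

theorem measurableSet_slab (k j : ℕ) : MeasurableSet (slab k j) := by
  unfold slab
  measurability

theorem isCompact_solidSimplex (k : ℕ) (s : ℝ) : IsCompact (solidSimplex k s) := by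
  have hc : IsClosed (solidSimplex k s) := by
    have : solidSimplex k s = (⋂ i, {t | 0 ≤ t i}) ∩ {t | ∑ i, t i ≤ s} := by
      ext t; simp [solidSimplex]
    rw [this]
    refine (isClosed_iInter fun i => isClosed_le (by fun_prop) (by fun_prop)).inter
      (isClosed_le (by fun_prop) (by fun_prop))
  refine (isCompact_univ_pi fun _ : Fin k => isCompact_Icc (a := (0 : ℝ))
    (b := s)).of_isClosed_subset
    hc fun t ht i _ => ⟨ht.1 i, ?_⟩
  exact (Finset.single_le_sum (f := t) (fun i _ => ht.1 i) (Finset.mem_univ i)).trans ht.2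

theorem natVec_add_mem_solidSimplex {k n j : ℕ} {m : Fin k → ℕ} (hm : m ∈ corners k n j)
    {r : Fin k → ℝ} (hr : r ∈ slab k j) : natVec m + r ∈ solidSimplex k n := by
  refine ⟨fun i => add_nonneg (Nat.cast_nonneg _) (hr.1 i).1, ?_⟩
  have h := mem_corners.1 hm
  have h' : (j : ℝ) + ∑ i, (m i : ℝ) ≤ n := by exact_mod_cast h
  simp only [Pi.add_apply, natVec, Finset.sum_add_distrib]
  linarith [hr.2.2]

theorem exists_mem_slab {k : ℕ} (t : Fin k → ℝ) :
    (fun i => Int.fract (t i)) ∈ slab k ⌈∑ i, Int.fract (t i)⌉₊ ∧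
      ⌈∑ i, Int.fract (t i)⌉₊ ≤ k := by
  have h0 : 0 ≤ ∑ i, Int.fract (t i) := Finset.sum_nonneg fun i _ => Int.fract_nonneg _
  refine ⟨⟨fun i => ⟨Int.fract_nonneg _, Int.fract_lt_one _⟩, ?_, Nat.le_ceil _⟩, ?_⟩
  · linarith [Nat.ceil_lt_add_one h0]
  · rw [Nat.ceil_le]
    calc ∑ i, Int.fract (t i) ≤ ∑ _i : Fin k, (1 : ℝ) :=
          Finset.sum_le_sum fun i _ => (Int.fract_lt_one _).le
      _ = k := by simp

theorem natVec_floor {k : ℕ} {t : Fin k → ℝ} (ht : ∀ i, 0 ≤ t i) :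
    t - natVec (fun i => ⌊t i⌋₊) = fun i => Int.fract (t i) := by
  funext i
  simp only [natVec, Pi.sub_apply, Int.fract]
  rw [natCast_floor_eq_intCast_floor (ht i)]

/-- The indices of the pieces of the simplex dilated by `n`: a level and a corner. -/
def pieceIndex (k n : ℕ) : Finset (Σ _ : ℕ, Fin k → ℕ) := (Finset.range (k + 1)).sigma (corners k n)

/-- The corner is the vector of floors and the level is the ceiling of the sum of the fractional
parts. As `n` and the floors are integers, the constraint on the coordinate sum survives rounding
the fractional sum up. -/
theorem solidSimplex_eq_biUnion (k n : ℕ) : solidSimplex k n =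
    ⋃ p ∈ pieceIndex k n, (fun t => t - natVec p.2) ⁻¹' slab k p.1 := by
  ext t
  simp only [Set.mem_iUnion, Set.mem_preimage, exists_prop, pieceIndex, Finset.mem_sigma,
    Finset.mem_range]
  constructor
  · intro ht
    obtain ⟨h1, h2⟩ := exists_mem_slab t
    refine ⟨⟨_, fun i => ⌊t i⌋₊⟩, ⟨Nat.lt_succ_of_le h2, ?_⟩, by rw [natVec_floor ht.1]; exact h1⟩
    rw [mem_corners]
    have h3 : ⌈∑ i, Int.fract (t i)⌉₊ ≤ n - ∑ i, ⌊t i⌋₊ ∧ ∑ i, ⌊t i⌋₊ ≤ n := by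
      have h4 : ∑ i, Int.fract (t i) + ((∑ i, ⌊t i⌋₊ : ℕ) : ℝ) = ∑ i, t i := by
        rw [← natVec_floor ht.1]
        push_cast
        rw [← Finset.sum_add_distrib]
        simp [natVec]
      have h5 : ∑ i, ⌊t i⌋₊ ≤ n := by
        have h0 : 0 ≤ ∑ i, Int.fract (t i) := Finset.sum_nonneg fun i _ => Int.fract_nonneg _
        have := ht.2
        have : ((∑ i, ⌊t i⌋₊ : ℕ) : ℝ) ≤ n := by linarith
        exact_mod_cast this
      refine ⟨?_, h5⟩
      rw [Nat.ceil_le, Nat.cast_sub h5]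
      linarith [ht.2]
    exact Nat.add_le_of_le_sub h3.2 h3.1
  · rintro ⟨⟨j, m⟩, ⟨_, hm⟩, hr⟩
    have := natVec_add_mem_solidSimplex hm hr
    simpa using this

theorem eq_floor_of_sub_mem_slab {k j : ℕ} {m : Fin k → ℕ} {t : Fin k → ℝ}
    (h : t - natVec m ∈ slab k j) :
    m = (fun i => ⌊t i⌋₊) ∧ j = ⌈∑ i, Int.fract (t i)⌉₊ := by
  have h1 : ∀ i, 0 ≤ t i := fun i => by
    have := (h.1 i).1
    simp only [Pi.sub_apply, natVec] at this
    linarith [Nat.cast_nonneg (α := ℝ) (m i)]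
  have h2 : m = fun i => ⌊t i⌋₊ := by
    funext i
    have := h.1 i
    simp only [Pi.sub_apply, natVec] at this
    rw [eq_comm, Nat.floor_eq_iff (h1 i)]
    constructor <;> linarith [this.1, this.2]
  refine ⟨h2, ?_⟩
  subst h2
  rw [natVec_floor h1] at h
  have h0 : 0 ≤ ∑ i, Int.fract (t i) := Finset.sum_nonneg fun i _ => Int.fract_nonneg _
  -- `Nat.ceil_eq_iff` needs a nonzero value; at level `0` the slab is just the origin.
  rcases Nat.eq_zero_or_pos j with rfl | hj
  · have := h.2.2
    rw [eq_comm, Nat.ceil_eq_zero]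
    simpa using this
  · rw [eq_comm, Nat.ceil_eq_iff hj.ne']
    refine ⟨?_, h.2.2⟩
    rw [Nat.cast_sub hj]
    simpa using h.2.1

theorem pairwiseDisjoint_pieces (k n : ℕ) : Set.Pairwise (pieceIndex k n : Set (Σ _ : ℕ, Fin k → ℕ))
    (Function.onFun Disjoint fun p => (fun t => t - natVec p.2) ⁻¹' slab k p.1) := by
  rintro ⟨j, m⟩ - ⟨j', m'⟩ - hne
  rw [Function.onFun, Set.disjoint_left]
  intro t h h'
  obtain ⟨h1, h2⟩ := eq_floor_of_sub_mem_slab h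
  obtain ⟨h3, h4⟩ := eq_floor_of_sub_mem_slab h'
  exact hne (by dsimp only at *; rw [h1, h2, h3, h4])

theorem measurableSet_piece {k : ℕ} (p : Σ _ : ℕ, Fin k → ℕ) :
    MeasurableSet ((fun t => t - natVec p.2) ⁻¹' slab k p.1) :=
  (measurable_id.sub_const _) (measurableSet_slab _ _)

theorem setIntegral_piece {k : ℕ} (p : Σ _ : ℕ, Fin k → ℕ) (φ : (Fin k → ℝ) → ℝ) :
    ∫ t in (fun t => t - natVec p.2) ⁻¹' slab k p.1, φ t =
      ∫ r in slab k p.1, φ (natVec p.2 + r) := by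
  have hmp : MeasurePreserving (fun t : Fin k → ℝ => t - natVec p.2) volume volume :=
    measurePreserving_sub_right _ _
  have he : MeasurableEmbedding (fun t : Fin k → ℝ => t - natVec p.2) :=
    (MeasurableEquiv.subRight (natVec p.2)).measurableEmbedding
  have := hmp.setIntegral_preimage_emb he (fun r => φ (natVec p.2 + r)) (slab k p.1)
  simpa using this

theorem integrableOn_piece {k : ℕ} (p : Σ _ : ℕ, Fin k → ℕ) {φ : (Fin k → ℝ) → ℝ}
    (h : IntegrableOn φ ((fun t => t - natVec p.2) ⁻¹' slab k p.1)) :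
    IntegrableOn (fun r => φ (natVec p.2 + r)) (slab k p.1) := by
  have hmp : MeasurePreserving (fun t : Fin k → ℝ => t - natVec p.2) volume volume :=
    measurePreserving_sub_right _ _
  have he : MeasurableEmbedding (fun t : Fin k → ℝ => t - natVec p.2) :=
    (MeasurableEquiv.subRight (natVec p.2)).measurableEmbedding
  rw [← hmp.integrableOn_comp_preimage he]
  convert h using 1
  funext t
  simp

theorem setIntegral_solidSimplex (k n : ℕ) {φ : (Fin k → ℝ) → ℝ}
    (h : IntegrableOn φ (solidSimplex k n)) :
    ∫ t in solidSimplex k n, φ t =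
      ∑ j ∈ Finset.range (k + 1), ∑ m ∈ corners k n j, ∫ r in slab k j, φ (natVec m + r) := by
  rw [← Finset.sum_sigma (Finset.range (k + 1)) (corners k n)
    (fun p => ∫ r in slab k p.1, φ (natVec p.2 + r))]
  rw [solidSimplex_eq_biUnion] at h ⊢
  rw [integral_biUnion_finset _ (fun p _ => measurableSet_piece p) (pairwiseDisjoint_pieces k n)]
  · exact Finset.sum_congr rfl fun p _ => setIntegral_piece p φ
  · exact fun p hp => h.mono_set (Set.subset_biUnion_of_mem (u := fun p : (Σ _ : ℕ, Fin k → ℕ) =>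
      (fun t : Fin k → ℝ => t - natVec p.2) ⁻¹' slab k p.1) hp)

theorem volume_slab_zero {k : ℕ} (hk : 1 ≤ k) : volume (slab k 0) = 0 := by
  have : slab k 0 ⊆ {0} := by
    intro r hr
    have h2 : ∑ i, r i ≤ 0 := by simpa using hr.2.2
    have h3 := (Finset.sum_eq_zero_iff_of_nonneg fun i _ => (hr.1 i).1).1
      (le_antisymm h2 (Finset.sum_nonneg fun i _ => (hr.1 i).1))
    exact funext fun i => h3 i (Finset.mem_univ i)
  have hne : Nonempty (Fin k) := ⟨⟨0, hk⟩⟩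
  exact measure_mono_null this (measure_singleton _)

/-- Stars and bars: the slack `s - ∑ i, m i`, put in front of `m`, gives the ways to write `s` as a
sum of `k + 1` natural numbers. -/
theorem card_corners (k s j : ℕ) : (corners k (j + s) j).card = (k + s).choose s := by
  have h : (corners k (j + s) j).card = (Finset.finsuppAntidiag (Finset.univ : Finset (Fin (k+1)))
    s).card := by
    refine Finset.card_bij (fun m _ => Finsupp.equivFunOnFinite.symm (Fin.cons (s - ∑ i, m i) m))
      ?_ ?_ ?_
    · intro m hm
      have := mem_corners.1 hm
      rw [Finset.mem_finsuppAntidiag]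
      refine ⟨?_, by simp⟩
      simp only [Finsupp.equivFunOnFinite_symm_apply_apply, Fin.sum_univ_succ, Fin.cons_zero,
        Fin.cons_succ]
      omega
    · intro m hm m' hm' h
      have := Finsupp.equivFunOnFinite.symm.injective h
      exact (Fin.cons_injective2 this).2
    · intro g hg
      rw [Finset.mem_finsuppAntidiag] at hg
      have hg' : g 0 + ∑ i : Fin k, g i.succ = s := by
        rw [← hg.1, Fin.sum_univ_succ]
      refine ⟨fun i => g i.succ, mem_corners.2 (by omega), ?_⟩
      ext i
      refine Fin.cases ?_ (fun i => ?_) i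
      · simp; omega
      · simp
  rw [h, Finset.card_finsuppAntidiag_nat_eq_choose]
  simp [Nat.add_right_comm]

theorem corners_eq_empty {k n j : ℕ} (h : n < j) : corners k n j = ∅ := by
  ext m
  simp only [mem_corners, Finset.notMem_empty, iff_false]
  omega

/-! ### Affine changes of variables and permutations of barycentric coordinates -/

theorem measurableEmbedding_affine {k : ℕ} {f : (Fin k → ℝ) →ₗ[ℝ] Fin k → ℝ}
    (hf : LinearMap.det f ≠ 0) (b : Fin k → ℝ) : MeasurableEmbedding fun t => f t + b := by
  have h1 : MeasurableEmbedding f :=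
    ((LinearMap.equivOfDetNeZero f hf).toContinuousLinearEquiv.toHomeomorph).measurableEmbedding
  exact (MeasurableEquiv.addRight b).measurableEmbedding.comp h1

theorem map_affine_volume {k : ℕ} {f : (Fin k → ℝ) →ₗ[ℝ] Fin k → ℝ}
    (hf : LinearMap.det f ≠ 0) (b : Fin k → ℝ) :
    Measure.map (fun t => f t + b) volume = ENNReal.ofReal |(LinearMap.det f)⁻¹| • volume := by
  have h1 : Measurable f := (LinearMap.continuous_of_finiteDimensional f).measurable
  rw [show (fun t => f t + b) = (fun t => t + b) ∘ f from rfl,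
    ← Measure.map_map (measurable_add_const b) h1,
    Real.map_linearMap_volume_pi_eq_smul_volume_pi hf, Measure.map_smul,
    (measurePreserving_add_right volume b).map_eq]

theorem integral_comp_affine {k : ℕ} {f : (Fin k → ℝ) →ₗ[ℝ] Fin k → ℝ}
    (hf : LinearMap.det f ≠ 0) (b : Fin k → ℝ) (φ : (Fin k → ℝ) → ℝ) :
    ∫ t, φ (f t + b) = |LinearMap.det f|⁻¹ * ∫ t, φ t := by
  rw [← (measurableEmbedding_affine hf b).integral_map φ, map_affine_volume hf b,
    integral_smul_measure, ENNReal.toReal_ofReal (abs_nonneg _), abs_inv, smul_eq_mul]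

theorem integrable_comp_affine {k : ℕ} {f : (Fin k → ℝ) →ₗ[ℝ] Fin k → ℝ}
    (hf : LinearMap.det f ≠ 0) (b : Fin k → ℝ) {φ : (Fin k → ℝ) → ℝ} (hφ : Integrable φ) :
    Integrable fun t => φ (f t + b) := by
  have := (measurableEmbedding_affine hf b).integrable_map_iff (μ := volume) (g := φ)
  rw [map_affine_volume hf b] at this
  exact this.1 (hφ.smul_measure ENNReal.ofReal_ne_top)

/-- The `k + 1` coordinates of a point of `ℝ^k` seen in the hyperplane of coordinate sum `c`. -/
def bary {k : ℕ} (c : ℝ) (t : Fin k → ℝ) : Fin (k + 1) → ℝ := Fin.cons (c - ∑ i, t i) t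

@[simp] theorem bary_zero {k : ℕ} (c : ℝ) (t : Fin k → ℝ) : bary c t 0 = c - ∑ i, t i := rfl

@[simp] theorem bary_succ {k : ℕ} (c : ℝ) (t : Fin k → ℝ) (i : Fin k) : bary c t i.succ = t i := rfl

theorem sum_bary {k : ℕ} (c : ℝ) (t : Fin k → ℝ) : ∑ i, bary c t i = c := by
  simp [Fin.sum_univ_succ]

/-- A permutation of the `k + 1` coordinates, acting on `ℝ^k`. -/
def permMap {k : ℕ} (c : ℝ) (π : Equiv.Perm (Fin (k + 1))) (t : Fin k → ℝ) : Fin k → ℝ :=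
  fun i => bary c t (π i.succ)

theorem bary_permMap {k : ℕ} (c : ℝ) (π : Equiv.Perm (Fin (k + 1))) (t : Fin k → ℝ) :
    bary c (permMap c π t) = fun i => bary c t (π i) := by
  funext i
  refine Fin.cases ?_ (fun i => rfl) i
  have h : ∑ i, bary c t (π i) = c := by rw [Equiv.sum_comp π, sum_bary]
  rw [Fin.sum_univ_succ] at h
  simp only [bary_zero, permMap]
  linarith

/-- The linear part of `permMap`. -/
def permLinear {k : ℕ} (π : Equiv.Perm (Fin (k + 1))) : (Fin k → ℝ) →ₗ[ℝ] Fin k → ℝ where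
  toFun := permMap 0 π
  map_add' x y := by
    funext i
    simp only [permMap, Pi.add_apply]
    refine Fin.cases ?_ (fun i => ?_) (π i.succ)
    · simp [Finset.sum_add_distrib]; ring
    · simp
  map_smul' a x := by
    funext i
    simp only [permMap, Pi.smul_apply, RingHom.id_apply]
    refine Fin.cases ?_ (fun i => ?_) (π i.succ)
    · simp [Finset.mul_sum]
    · simp

theorem permLinear_pow {k : ℕ} (π : Equiv.Perm (Fin (k + 1))) (n : ℕ) :
    permLinear π ^ n = permLinear (π ^ n) := by
  induction n with
  | zero => ext; simp [permLinear, permMap]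
  | succ n ih =>
    rw [pow_succ', ih]
    refine LinearMap.ext fun t => funext fun i => ?_
    change bary 0 (permMap 0 (π ^ n) t) (π i.succ) = bary 0 t ((π ^ (n + 1)) i.succ)
    rw [bary_permMap, pow_succ]
    rfl

/-- A permutation has finite order, so a positive power of the absolute determinant is `1`. -/
theorem abs_det_permLinear {k : ℕ} (π : Equiv.Perm (Fin (k + 1))) :
    |LinearMap.det (permLinear π)| = 1 := by
  have h : |LinearMap.det (permLinear π)| ^ orderOf π = 1 := by
    rw [← abs_pow, ← map_pow, permLinear_pow, pow_orderOf_eq_one]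
    have : permLinear (1 : Equiv.Perm (Fin (k + 1))) = 1 := by ext; simp [permLinear, permMap]
    rw [this]; simp
  exact (pow_eq_one_iff_of_nonneg (abs_nonneg _) (orderOf_pos π).ne').1 h

theorem permMap_eq {k : ℕ} (c : ℝ) (π : Equiv.Perm (Fin (k + 1))) (t : Fin k → ℝ) :
    permMap c π t = permLinear π t + permMap c π 0 := by
  funext i
  simp only [permLinear, permMap, LinearMap.coe_mk, AddHom.coe_mk, Pi.add_apply]
  refine Fin.cases ?_ (fun i => ?_) (π i.succ)
  · simp; ring
  · simp

theorem integral_comp_permMap {k : ℕ} (c : ℝ) (π : Equiv.Perm (Fin (k + 1)))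
    (φ : (Fin k → ℝ) → ℝ) : ∫ t, φ (permMap c π t) = ∫ t, φ t := by
  have h := abs_det_permLinear π
  have h0 : LinearMap.det (permLinear π) ≠ 0 := fun h0 => by simp [h0] at h
  rw [show (fun t => φ (permMap c π t)) = fun t => φ (permLinear π t + permMap c π 0) from
    funext fun t => by rw [← permMap_eq]]
  rw [integral_comp_affine h0, h]
  simp

theorem integrable_comp_permMap {k : ℕ} (c : ℝ) (π : Equiv.Perm (Fin (k + 1)))
    {φ : (Fin k → ℝ) → ℝ} (hφ : Integrable φ) : Integrable fun t => φ (permMap c π t) := by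
  have h := abs_det_permLinear π
  have h0 : LinearMap.det (permLinear π) ≠ 0 := fun h0 => by simp [h0] at h
  rw [show (fun t => φ (permMap c π t)) = fun t => φ (permLinear π t + permMap c π 0) from
    funext fun t => by rw [← permMap_eq]]
  exact integrable_comp_affine h0 _ hφ

theorem mem_solidSimplex_one_iff {k : ℕ} {t : Fin k → ℝ} :
    t ∈ solidSimplex k 1 ↔ ∀ i, 0 ≤ bary 1 t i := by
  constructor
  · intro h i
    refine Fin.cases ?_ (fun i => h.1 i) i
    simpa using h.2
  · intro h
    exact ⟨fun i => h i.succ, by simpa using h 0⟩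

/-! ### Averaging over the slabs -/

/-- The integral over the slab of level `j` of a function dominated by the sums of `F` over
the decompositions into `j` points of the simplex is at most `B` times the integral of `F`. -/
def SlabBound (k j : ℕ) (B : ℝ) : Prop :=
  ∀ F G : (Fin k → ℝ) → ℝ, (∀ x ∈ solidSimplex k 1, 0 ≤ F x) → IntegrableOn F (solidSimplex k 1) →
    IntegrableOn G (slab k j) →
    (∀ x : Fin j → Fin k → ℝ, (∀ i, x i ∈ solidSimplex k 1) → ∑ i, x i ∈ slab k j →
      G (∑ i, x i) ≤ ∑ i, F (x i)) →
    ∫ r in slab k j, G r ≤ B * ∫ x in solidSimplex k 1, F x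

theorem slabBound_one (k : ℕ) : SlabBound k 1 1 := by
  intro F G hF hFi hGi h
  have hsub : slab k 1 ⊆ solidSimplex k 1 :=
    fun r hr => ⟨fun i => (hr.1 i).1, by simpa using hr.2.2⟩
  rw [one_mul]
  refine (setIntegral_mono_on hGi (hFi.mono_set hsub) (measurableSet_slab _ _) fun r hr => ?_).trans
    (setIntegral_mono_set hFi ?_ hsub.eventuallyLE)
  · simpa using h (fun _ => r) (fun _ => hsub hr) (by simpa using hr)
  · exact (ae_restrict_mem (measurableSet_solidSimplex _ _)).mono hF

/-- On the top slab the point `1 - u` is the sum of `k` cyclic shifts of `u`. -/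
theorem slabBound_top (k : ℕ) : SlabBound k k k := by
  intro F G hF hFi hGi h
  set Fh := (solidSimplex k 1).indicator F with hFh
  have hm := measurableSet_solidSimplex k 1
  have hFhi : Integrable Fh := (integrable_indicator_iff hm).2 hFi
  have hFh0 : ∀ x, 0 ≤ Fh x := fun x => Set.indicator_nonneg hF x
  set X : Fin k → (Fin k → ℝ) → Fin k → ℝ :=
    fun s r => permMap 1 (Equiv.addRight s.succ) (1 - r) with hX
  have hXi : ∀ s, Integrable fun r => Fh (X s r) := fun s =>
    (integrable_comp_permMap 1 (Equiv.addRight s.succ) hFhi).comp_sub_left 1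
  have hXe : ∀ s, ∫ r, Fh (X s r) = ∫ x in solidSimplex k 1, F x := fun s => by
    rw [hX]
    rw [integral_sub_left_eq_self (fun t => Fh (permMap 1 (Equiv.addRight s.succ) t)),
      integral_comp_permMap, hFh, integral_indicator hm]
  have hpt : ∀ r ∈ slab k k, G r ≤ ∑ s, Fh (X s r) := by
    intro r hr
    -- The omitted coordinate of `1 - r` is `∑ r - (k - 1)`, which is positive on the top slab.
    have hu : ∀ i, 0 ≤ bary 1 (1 - r) i := by
      intro i
      refine Fin.cases ?_ (fun i => ?_) i
      · have := hr.2.1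
        simp; linarith
      · have := (hr.1 i).2
        simp; linarith
    have hmem : ∀ s, X s r ∈ solidSimplex k 1 := fun s => by
      rw [mem_solidSimplex_one_iff, hX]
      simp only [bary_permMap]
      exact fun i => hu _
    -- All `k + 1` cyclic shifts together put the full sum `1` in every coordinate; leaving out the
    -- identity shift subtracts `1 - r`.
    have hsum : ∑ s, X s r = r := by
      funext i
      rw [Finset.sum_apply]
      have h1 : ∑ s : Fin (k + 1), bary 1 (1 - r) (i.succ + s) = 1 := by
        exact (Equiv.sum_comp (Equiv.addLeft i.succ) (bary 1 (1 - r))).trans (sum_bary _ _)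
      rw [Fin.sum_univ_succ, add_zero, bary_succ] at h1
      have : ∑ s, X s r i = ∑ s : Fin k, bary 1 (1 - r) (i.succ + s.succ) := rfl
      rw [this]
      simp only [Pi.sub_apply, Pi.one_apply] at h1
      linarith
    have := h (fun s => X s r) hmem (by rw [hsum]; exact hr)
    rw [hsum] at this
    refine this.trans_eq (Finset.sum_congr rfl fun s _ => ?_)
    rw [hFh, Set.indicator_of_mem (hmem s)]
  calc ∫ r in slab k k, G r ≤ ∫ r in slab k k, ∑ s, Fh (X s r) :=
        setIntegral_mono_on hGi (integrable_finsetSum _ fun s _ => hXi s).integrableOn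
          (measurableSet_slab _ _) hpt
    _ ≤ ∫ r, ∑ s, Fh (X s r) :=
        setIntegral_le_integral (integrable_finsetSum _ fun s _ => hXi s)
          (Filter.Eventually.of_forall fun r => Finset.sum_nonneg fun s _ => hFh0 _)
    _ = k * ∫ x in solidSimplex k 1, F x := by
        rw [integral_finsetSum _ fun s _ => hXi s]
        simp [hXe]

/-! ### The middle slab in dimension three -/

/-- A pointwise bound for the sum over a few rearrangements of `q` thereby becomes a bound for the
sum over the whole symmetric group. -/
theorem sum_perm_comp {k : ℕ} (σ : Equiv.Perm (Fin k)) (g : (Fin k → ℝ) → ℝ) (q : Fin k → ℝ) :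
    ∑ π : Equiv.Perm (Fin k), g (fun i => q (π (σ i))) =
      ∑ π : Equiv.Perm (Fin k), g (fun i => q (π i)) :=
  Equiv.sum_comp (Equiv.mulRight σ) fun π : Equiv.Perm (Fin k) => g fun i => q (π i)

/-- The octants of the octahedron in which the first coordinate is extremal. -/
noncomputable def octantWeight (a b c d : ℝ) : ℝ :=
  if (1 < a + b ∧ 1 < a + c ∧ 1 < a + d) ∨ (a + b < 1 ∧ a + c < 1 ∧ a + d < 1) then 1 else 0

/-- The image of an octant of the octahedron under its first map to the simplex. -/
def wedgeA : Set (Fin 4 → ℝ) := {q | q 1 < q 2 ∧ q 2 < q 0 + q 1}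

/-- The image of an octant of the octahedron under its second map to the simplex. -/
def wedgeB : Set (Fin 4 → ℝ) := {q | q 2 + q 3 < q 0}

/-- The cone over a facet of the simplex from the barycenter. -/
def facetCone : Set (Fin 4 → ℝ) := {q | q 0 < q 1 ∧ q 0 < q 2 ∧ q 0 < q 3}

/-- Complementary pairs have sums on opposite sides of `1`, so three signs determine the octant. In
each of the eight octants exactly one coordinate has all its pair sums on the same side. Moving each
coordinate to the front in turn thus counts `1`, and `4` times the sum over permutations is `24`. -/
theorem sum_octantWeight {q : Fin 4 → ℝ} (hq : ∑ i, q i = 2)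
    (hne : ∀ i j, i ≠ j → q i + q j ≠ 1) :
    ∑ π : Equiv.Perm (Fin 4), octantWeight (q (π 0)) (q (π 1)) (q (π 2)) (q (π 3)) = 6 := by
  set g : (Fin 4 → ℝ) → ℝ := fun q => octantWeight (q 0) (q 1) (q 2) (q 3) with hg
  have key : ∀ q : Fin 4 → ℝ, ∑ i, q i = 2 → (∀ i j, i ≠ j → q i + q j ≠ 1) →
      ∑ a : Fin 4, g (fun i => q (Equiv.swap 0 a i)) = 1 := by
    intro q hq hne
    rw [Fin.sum_univ_four] at hq
    have s1 : ∀ i, Equiv.swap (0 : Fin 4) 1 i = ![1, 0, 2, 3] i := by decide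
    have s2 : ∀ i, Equiv.swap (0 : Fin 4) 2 i = ![2, 1, 0, 3] i := by decide
    have s3 : ∀ i, Equiv.swap (0 : Fin 4) 3 i = ![3, 1, 2, 0] i := by decide
    have h1 := hne 0 1 (by decide)
    have h2 := hne 0 2 (by decide)
    have h3 := hne 0 3 (by decide)
    have h4 : q 3 = 2 - q 0 - q 1 - q 2 := by linarith
    simp only [Fin.sum_univ_four, hg, s1, s2, s3, Equiv.swap_self, Equiv.refl_apply]
    simp only [Matrix.cons_val]
    rw [h4] at h3 ⊢
    clear hq hne h4 s1 s2 s3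
    unfold octantWeight
    rcases lt_or_gt_of_ne h1 with h1 | h1 <;> rcases lt_or_gt_of_ne h2 with h2 | h2 <;>
      rcases lt_or_gt_of_ne h3 with h3 | h3 <;> grind
  have h : ∑ a : Fin 4, ∑ π : Equiv.Perm (Fin 4), g (fun i => q (π (Equiv.swap 0 a i))) = 24 := by
    rw [Finset.sum_comm, Finset.sum_congr rfl fun π _ => key (fun i => q (π i))
      (by rw [Equiv.sum_comp π, hq]) fun i j hij => hne _ _ (π.injective.ne hij)]
    simp [Fintype.card_perm, Nat.factorial]
  simp only [sum_perm_comp _ g] at h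
  simp only [Finset.sum_const, Finset.card_univ, Fintype.card_fin, nsmul_eq_mul] at h
  push_cast at h
  linarith

/-- At most one of the four coordinates is strictly smaller than the rest. -/
theorem sum_indicator_facetCone_le (q : Fin 4 → ℝ) :
    ∑ π : Equiv.Perm (Fin 4), facetCone.indicator (1 : (Fin 4 → ℝ) → ℝ) (fun i => q (π i)) ≤ 6 := by
  have key : ∀ q : Fin 4 → ℝ,
      ∑ a : Fin 4, facetCone.indicator (1 : (Fin 4 → ℝ) → ℝ) (fun i => q (Equiv.swap 0 a i))
        ≤ 1 := by
    intro q
    have s1 : ∀ i, Equiv.swap (0 : Fin 4) 1 i = ![1, 0, 2, 3] i := by decide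
    have s2 : ∀ i, Equiv.swap (0 : Fin 4) 2 i = ![2, 1, 0, 3] i := by decide
    have s3 : ∀ i, Equiv.swap (0 : Fin 4) 3 i = ![3, 1, 2, 0] i := by decide
    simp only [Fin.sum_univ_four, Set.indicator, facetCone, Set.mem_ofPred_eq, s1, s2, s3,
      Equiv.swap_self, Equiv.refl_apply, Pi.one_apply]
    simp only [Matrix.cons_val]
    grind
  have h : ∑ a : Fin 4, ∑ π : Equiv.Perm (Fin 4), facetCone.indicator (1 : (Fin 4 → ℝ) → ℝ)
      (fun i => q (π (Equiv.swap 0 a i))) ≤ 24 := by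
    rw [Finset.sum_comm]
    refine (Finset.sum_le_sum fun π _ => key (fun i => q (π i))).trans_eq ?_
    simp [Fintype.card_perm, Nat.factorial]
  simp only [sum_perm_comp _ (facetCone.indicator 1)] at h
  simp only [Finset.sum_const, Finset.card_univ, Fintype.card_fin, nsmul_eq_mul] at h
  push_cast at h
  linarith

/-- Whether or not three nonnegative numbers satisfy the triangle inequalities, their orderings lie
in the two kinds of wedges at most three times altogether. -/
theorem sum_wedges_three_le {a b c : ℝ} (ha : 0 ≤ a) (hb : 0 ≤ b) (hc : 0 ≤ c)
    (u v : ℝ → ℝ → ℝ → ℝ) (hu : ∀ a b c, u a b c = if b < c ∧ c < a + b then 1 else 0)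
    (hv : ∀ a b c, v a b c = if b + c < a then 1 else 0) :
    (u a b c + v a b c) + (u a c b + v a c b) + (u b a c + v b a c) + (u b c a + v b c a) +
      (u c a b + v c a b) + (u c b a + v c b a) ≤ 3 := by
  simp only [hu, hv]
  rcases le_total a b with h1 | h1 <;> rcases le_total b c with h2 | h2 <;>
    rcases le_total a c with h3 | h3 <;> grind

theorem sum_indicator_wedges_le {q : Fin 4 → ℝ} (hq : ∀ i, 0 ≤ q i) :
    ∑ π : Equiv.Perm (Fin 4), wedgeA.indicator (1 : (Fin 4 → ℝ) → ℝ) (fun i => q (π i)) +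
      ∑ π : Equiv.Perm (Fin 4), wedgeB.indicator (1 : (Fin 4 → ℝ) → ℝ) (fun i => q (π i)) ≤ 12 := by
  have w01 : ∀ i, Equiv.swap (0 : Fin 4) 1 i = ![1, 0, 2, 3] i := by decide
  have w02 : ∀ i, Equiv.swap (0 : Fin 4) 2 i = ![2, 1, 0, 3] i := by decide
  have w12 : ∀ i, Equiv.swap (1 : Fin 4) 2 i = ![0, 2, 1, 3] i := by decide
  have w23 : ∀ i, Equiv.swap (2 : Fin 4) 3 i = ![0, 1, 3, 2] i := by decide
  set u : ℝ → ℝ → ℝ → ℝ := fun a b c => if b < c ∧ c < a + b then 1 else 0 with hu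
  set v : ℝ → ℝ → ℝ → ℝ := fun a b c => if b + c < a then 1 else 0 with hv
  have hA : ∀ q : Fin 4 → ℝ, wedgeA.indicator (1 : (Fin 4 → ℝ) → ℝ) q = u (q 0) (q 1) (q 2) :=
    fun q => by
      by_cases h : q 1 < q 2 ∧ q 2 < q 0 + q 1
      · rw [Set.indicator_of_mem (show q ∈ wedgeA from h)]
        exact (if_pos h).symm
      · rw [Set.indicator_of_notMem (show q ∉ wedgeA from h)]
        exact (if_neg h).symm
  have hB : ∀ q : Fin 4 → ℝ, wedgeB.indicator (1 : (Fin 4 → ℝ) → ℝ) q = v (q 0) (q 2) (q 3) :=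
    fun q => by
      by_cases h : q 2 + q 3 < q 0
      · rw [Set.indicator_of_mem (show q ∈ wedgeB from h)]
        exact (if_pos h).symm
      · rw [Set.indicator_of_notMem (show q ∉ wedgeB from h)]
        exact (if_neg h).symm
  set g : (Fin 4 → ℝ) → ℝ := fun q => u (q 0) (q 1) (q 2) + v (q 0) (q 1) (q 2) with hg
  -- A relabelling makes both wedges conditions on the same three coordinates, so that the
  -- three-number inequality applies.
  have hB' : ∑ π : Equiv.Perm (Fin 4), v (q (π 0)) (q (π 2)) (q (π 3)) =
      ∑ π : Equiv.Perm (Fin 4), v (q (π 0)) (q (π 1)) (q (π 2)) := by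
    have := sum_perm_comp (Equiv.swap (1 : Fin 4) 2 * Equiv.swap 2 3)
      (fun q => v (q 0) (q 1) (q 2)) q
    simpa only [Equiv.Perm.mul_apply, w01, w02, w12, w23, Matrix.cons_val] using this
  have hsum : ∑ π : Equiv.Perm (Fin 4), wedgeA.indicator (1 : (Fin 4 → ℝ) → ℝ) (fun i => q (π i)) +
      ∑ π : Equiv.Perm (Fin 4), wedgeB.indicator (1 : (Fin 4 → ℝ) → ℝ) (fun i => q (π i)) =
      ∑ π : Equiv.Perm (Fin 4), g (fun i => q (π i)) := by
    simp only [hA, hB, hB', hg, Finset.sum_add_distrib]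
  rw [hsum]
  -- Each of the six orderings of the first three coordinates gives the same total, so six times the
  -- total is at most `24 * 3`.
  have ev : ∀ (σ : Equiv.Perm (Fin 4)), ∑ π : Equiv.Perm (Fin 4),
      (u (q (π (σ 0))) (q (π (σ 1))) (q (π (σ 2))) + v (q (π (σ 0))) (q (π (σ 1))) (q (π (σ 2)))) =
        ∑ π : Equiv.Perm (Fin 4), g (fun i => q (π i)) := fun σ => sum_perm_comp σ g q
  have e1 := ev 1
  have e2 := ev (Equiv.swap 1 2)
  have e3 := ev (Equiv.swap 0 1)
  have e4 := ev (Equiv.swap 0 1 * Equiv.swap 1 2)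
  have e5 := ev (Equiv.swap 0 2 * Equiv.swap 1 2)
  have e6 := ev (Equiv.swap 0 2)
  simp only [Equiv.Perm.one_apply] at e1
  simp only [Equiv.Perm.mul_apply, w01, w02, w12, Matrix.cons_val] at e2 e3 e4 e5 e6
  have h := Finset.sum_le_sum (s := Finset.univ) fun (π : Equiv.Perm (Fin 4)) _ =>
    sum_wedges_three_le (hq (π 0)) (hq (π 1)) (hq (π 2)) u v (fun _ _ _ => rfl) (fun _ _ _ => rfl)
  rw [Finset.sum_add_distrib, Finset.sum_add_distrib, Finset.sum_add_distrib,
    Finset.sum_add_distrib,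
    Finset.sum_add_distrib, e1, e2, e3, e4, e5, e6] at h
  simp only [Finset.sum_const, Finset.card_univ, Fintype.card_perm, Fintype.card_fin, nsmul_eq_mul,
    Nat.factorial] at h
  push_cast at h
  linarith

/-! ### Integration over octants and the affine maps that split them -/

theorem measurable_bary {k : ℕ} (c : ℝ) : Measurable (bary c : (Fin k → ℝ) → Fin (k + 1) → ℝ) := by
  refine measurable_pi_lambda _ fun i => Fin.cases ?_ (fun i => ?_) i
  · simp only [bary_zero]; fun_prop
  · simp only [bary_succ]; fun_prop

theorem measurableSet_wedgeA : MeasurableSet wedgeA :=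
  (measurableSet_lt (measurable_pi_apply 1) (measurable_pi_apply 2)).inter
    (measurableSet_lt (measurable_pi_apply 2) (by fun_prop))

theorem measurableSet_wedgeB : MeasurableSet wedgeB :=
  measurableSet_lt (by fun_prop) (measurable_pi_apply 0)

theorem measurableSet_facetCone : MeasurableSet facetCone :=
  (measurableSet_lt (measurable_pi_apply 0) (measurable_pi_apply 1)).inter
    ((measurableSet_lt (measurable_pi_apply 0) (measurable_pi_apply 2)).inter
      (measurableSet_lt (measurable_pi_apply 0) (measurable_pi_apply 3)))

/-- Integrating over the image of an affine map with determinant `1 / 2`. -/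
theorem integral_weight_comp_affine {k : ℕ} {f : (Fin k → ℝ) →ₗ[ℝ] Fin k → ℝ}
    (hf : LinearMap.det f = 1 / 2) (b : Fin k → ℝ) (π : Equiv.Perm (Fin (k + 1)))
    {W : Set (Fin (k + 1) → ℝ)} (hW : MeasurableSet W) {F : (Fin k → ℝ) → ℝ} (hF : Integrable F) :
    (Integrable fun r => W.indicator (1 : (Fin (k + 1) → ℝ) → ℝ) (bary 1 (f (permMap 2 π r) + b)) *
      F (permMap 1 π⁻¹ (f (permMap 2 π r) + b))) ∧
    (Integrable fun s => W.indicator (1 : (Fin (k + 1) → ℝ) → ℝ) (fun i => bary 1 s (π i)) * F s) ∧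
    ∫ r, W.indicator (1 : (Fin (k + 1) → ℝ) → ℝ) (bary 1 (f (permMap 2 π r) + b)) *
      F (permMap 1 π⁻¹ (f (permMap 2 π r) + b)) =
    2 * ∫ s, W.indicator (1 : (Fin (k + 1) → ℝ) → ℝ) (fun i => bary 1 s (π i)) * F s := by
  have hf0 : LinearMap.det f ≠ 0 := by rw [hf]; norm_num
  set φ : (Fin k → ℝ) → ℝ := fun q => W.indicator (1 : (Fin (k + 1) → ℝ) → ℝ) (bary 1 q) *
    F (permMap 1 π⁻¹ q) with hφ
  have hφi : Integrable φ := by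
    have : φ = (bary 1 ⁻¹' W).indicator (fun q => F (permMap 1 π⁻¹ q)) := by
      funext q
      by_cases h : bary 1 q ∈ W
      · simp [hφ, h]
      · simp [hφ, h]
    rw [this]
    exact (integrable_comp_permMap 1 π⁻¹ hF).indicator (measurable_bary 1 hW)
  have hinv : ∀ s : Fin k → ℝ, permMap 1 π⁻¹ (permMap 1 π s) = s := fun s => by
    funext i
    change bary 1 (permMap 1 π s) (π⁻¹ i.succ) = s i
    rw [bary_permMap]
    simp
  have hs : (fun s => W.indicator (1 : (Fin (k + 1) → ℝ) → ℝ) (fun i => bary 1 s (π i)) * F s) =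
      fun s => φ (permMap 1 π s) := by
    funext s
    simp only [hφ, bary_permMap, hinv]
  refine ⟨integrable_comp_permMap 2 π (integrable_comp_affine hf0 b hφi), ?_, ?_⟩
  · rw [hs]
    exact integrable_comp_permMap 1 π hφi
  · rw [hs, integral_comp_permMap 1 π φ]
    rw [integral_comp_permMap 2 π fun r => φ (f r + b), integral_comp_affine hf0, hf]
    norm_num

/-- The walls between octants are level sets of nonzero linear functionals, hence null. -/
theorem ae_bary_add_ne (c : ℝ) (i j : Fin 4) (hij : i ≠ j) :
    ∀ᵐ r : Fin 3 → ℝ, bary c r i + bary c r j ≠ 1 := by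
  have key : ∀ (L : (Fin 3 → ℝ) →ₗ[ℝ] ℝ) (a : ℝ), L ≠ 0 → volume {r | L r = a} = 0 := by
    intro L a hL
    obtain ⟨v, hv⟩ : ∃ v, L v = a := LinearMap.surjective hL a
    have h1 : volume ((LinearMap.ker L : Submodule ℝ (Fin 3 → ℝ)) : Set (Fin 3 → ℝ)) = 0 :=
      Measure.addHaar_submodule _ _ fun h => hL (LinearMap.ker_eq_top.1 h)
    have h2 : {r | L r = a} = (fun r => r - v) ⁻¹' (LinearMap.ker L : Submodule ℝ (Fin 3 → ℝ)) := by
      ext r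
      simp [hv, sub_eq_zero]
    rw [h2, (measurePreserving_sub_right volume v).measure_preimage
      (LinearMap.ker L).closed_of_finiteDimensional.measurableSet.nullMeasurableSet, h1]
  set L : (Fin 3 → ℝ) →ₗ[ℝ] ℝ :=
    { toFun := fun r => bary 0 r i + bary 0 r j
      map_add' := fun x y => by
        have h : ∀ i, bary 0 (x + y) i = bary 0 x i + bary 0 y i := fun i =>
          Fin.cases (by simp [Finset.sum_add_distrib]; ring) (fun i => by simp) i
        rw [h, h]; ring
      map_smul' := fun a x => by
        have h : ∀ i, bary 0 (a • x) i = a * bary 0 x i := fun i =>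
          Fin.cases (by simp [Finset.mul_sum]) (fun i => by simp) i
        rw [h, h]; simp; ring } with hL
  have hLne : L ≠ 0 := by
    intro h0
    -- The barycentric vector `(-7, 1, 2, 4)` has total `0`, but no two of its entries cancel, so
    -- one test point serves all pairs.
    have e1 : bary 0 (![1, 2, 4] : Fin 3 → ℝ) i + bary 0 ![1, 2, 4] j = 0 :=
      LinearMap.congr_fun h0 ![1, 2, 4]
    have hv : ∀ i, bary 0 (![1, 2, 4] : Fin 3 → ℝ) i = (![-7, 1, 2, 4] : Fin 4 → ℝ) i := fun i =>
      Fin.cases (by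
        change (0 : ℝ) - ∑ i : Fin 3, (![1, 2, 4] : Fin 3 → ℝ) i = -7
        rw [Fin.sum_univ_three]
        simp only [Matrix.cons_val]
        norm_num) (fun i => by simp) i
    have hne : ∀ i j : Fin 4, i ≠ j →
        (![-7, 1, 2, 4] : Fin 4 → ℝ) i + (![-7, 1, 2, 4] : Fin 4 → ℝ) j ≠ 0 := by
      intro i j
      fin_cases i <;> fin_cases j <;> norm_num
    rw [hv, hv] at e1
    exact hne i j hij e1
  have h := key L (1 - ((bary c 0 i : ℝ) + bary c 0 j)) hLne
  rw [ae_iff]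
  convert h using 2
  ext r
  have hb : ∀ i, bary c r i = bary 0 r i + bary c 0 i := fun i =>
    Fin.cases (by simp; ring) (fun i => by simp) i
  have hi := hb i
  have hj := hb j
  simp only [hL, LinearMap.coe_mk, AddHom.coe_mk, not_not, Set.mem_ofPred_eq]
  constructor <;> intro h <;> linarith

/-- Two points of the simplex whose permuted coordinates add up to those of `r` add up to `r`. -/
theorem permMap_inv_add {k : ℕ} (π : Equiv.Perm (Fin (k + 1))) {x y r : Fin k → ℝ}
    (h : x + y = permMap 2 π r) : permMap 1 π⁻¹ x + permMap 1 π⁻¹ y = r := by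
  have h2 : ∀ i, bary 1 x i + bary 1 y i = bary 2 (x + y) i := fun i =>
    Fin.cases (by simp [Finset.sum_add_distrib]; ring) (fun i => by simp) i
  funext i
  change bary 1 x (π⁻¹ i.succ) + bary 1 y (π⁻¹ i.succ) = r i
  rw [h2, h, bary_permMap]
  simp

theorem permMap_mem_solidSimplex {k : ℕ} (π : Equiv.Perm (Fin (k + 1))) {x : Fin k → ℝ}
    (h : x ∈ solidSimplex k 1) : permMap 1 π x ∈ solidSimplex k 1 := by
  rw [mem_solidSimplex_one_iff] at h ⊢
  rw [bary_permMap]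
  exact fun i => h _

theorem bary_two_mem_Icc {r : Fin 3 → ℝ} (hr : r ∈ slab 3 2) (i : Fin 4) :
    0 ≤ bary 2 r i ∧ bary 2 r i ≤ 1 := by
  have h1 := hr.2.1
  have h2 := hr.2.2
  push_cast at h1 h2
  refine Fin.cases ?_ (fun i => ?_) i
  · rw [bary_zero]
    constructor <;> linarith
  · exact ⟨(hr.1 i).1, (hr.1 i).2.le⟩

/-- The linear parts of the affine maps from the octants of the octahedron to the simplex. -/
noncomputable def octantMatrix : Fin 4 → Matrix (Fin 3) (Fin 3) ℝ :=
  ![!![1, 1, 1; 1/2, 1, 1/2; -1, -1, 0], !![0, -1, -1; -1/2, 0, -1/2; 1, 1, 1],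
    !![1/2, 1/2, -1/2; -1/2, 1/2, 1/2; 1/2, -1/2, 1/2],
    !![1/2, -1/2, 1/2; 1/2, 1/2, -1/2; -1/2, 1/2, 1/2]]

/-- The constant parts of the affine maps from the octants of the octahedron to the simplex. -/
noncomputable def octantShift : Fin 4 → Fin 3 → ℝ :=
  ![![-1, -1/2, 1], ![1, 1/2, -1], ![0, 0, 0], ![0, 0, 0]]

/-- The images of the affine maps from the octants of the octahedron to the simplex. -/
def octantImage : Fin 4 → Set (Fin 4 → ℝ) := ![wedgeA, wedgeB, facetCone, facetCone]

/-- The affine maps from the octants of the octahedron to the simplex. -/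
noncomputable def octantMap (a : Fin 4) (t : Fin 3 → ℝ) : Fin 3 → ℝ :=
  Matrix.toLin' (octantMatrix a) t + octantShift a

theorem det_octantMatrix (a : Fin 4) : LinearMap.det (Matrix.toLin' (octantMatrix a)) = 1 / 2 := by
  rw [LinearMap.det_toLin']
  fin_cases a <;> simp [octantMatrix, Matrix.det_fin_three] <;> norm_num

theorem octantMap_zero (t : Fin 3 → ℝ) : octantMap 0 t =
    ![t 0 + t 1 + t 2 - 1, (t 0 + t 2) / 2 + t 1 - 1 / 2, 1 - t 0 - t 1] := by
  funext i
  fin_cases i <;>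
    simp [octantMap, octantMatrix, octantShift, Matrix.toLin'_apply, dotProduct,
      Fin.sum_univ_three] <;> ring

theorem octantMap_one (t : Fin 3 → ℝ) : octantMap 1 t =
    ![1 - t 1 - t 2, (1 - t 0 - t 2) / 2, t 0 + t 1 + t 2 - 1] := by
  funext i
  fin_cases i <;>
    simp [octantMap, octantMatrix, octantShift, Matrix.toLin'_apply, dotProduct,
      Fin.sum_univ_three] <;> ring

theorem octantMap_two (t : Fin 3 → ℝ) : octantMap 2 t =
    ![(t 0 + t 1 - t 2) / 2, (t 1 + t 2 - t 0) / 2, (t 0 + t 2 - t 1) / 2] := by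
  funext i
  fin_cases i <;>
    simp [octantMap, octantMatrix, octantShift, Matrix.toLin'_apply, dotProduct,
      Fin.sum_univ_three] <;> ring

theorem octantMap_three (t : Fin 3 → ℝ) : octantMap 3 t =
    ![(t 0 + t 2 - t 1) / 2, (t 0 + t 1 - t 2) / 2, (t 1 + t 2 - t 0) / 2] := by
  funext i
  fin_cases i <;>
    simp [octantMap, octantMatrix, octantShift, Matrix.toLin'_apply, dotProduct,
      Fin.sum_univ_three] <;> ring

theorem bary_three (x : Fin 3 → ℝ) :
    bary 1 x 0 = 1 - (x 0 + x 1 + x 2) ∧ bary 1 x 1 = x 0 ∧ bary 1 x 2 = x 1 ∧ bary 1 x 3 = x 2 :=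
  ⟨by rw [bary_zero, Fin.sum_univ_three], rfl, rfl, rfl⟩

/-- A point of an octant is the sum of its images under two affine maps to the simplex. -/
theorem octantMap_spec {t : Fin 3 → ℝ} (h0 : ∀ i, 0 ≤ bary 2 t i) (h1 : ∀ i, bary 2 t i ≤ 1)
    (ht : octantWeight (bary 2 t 0) (bary 2 t 1) (bary 2 t 2) (bary 2 t 3) ≠ 0) :
    ∃ a b : Fin 4, a ≠ b ∧ octantMap a t + octantMap b t = t ∧
      octantMap a t ∈ solidSimplex 3 1 ∧ octantMap b t ∈ solidSimplex 3 1 ∧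
      bary 1 (octantMap a t) ∈ octantImage a ∧ bary 1 (octantMap b t) ∈ octantImage b := by
  have b0 : bary 2 t 0 = 2 - (t 0 + t 1 + t 2) := by rw [bary_zero, Fin.sum_univ_three]
  have b1 : bary 2 t 1 = t 0 := rfl
  have b2 : bary 2 t 2 = t 1 := rfl
  have b3 : bary 2 t 3 = t 2 := rfl
  have l0 := h0 0
  have l1 := h0 1
  have l2 := h0 2
  have l3 := h0 3
  have u0 := h1 0
  have u1 := h1 1
  have u2 := h1 2
  have u3 := h1 3
  rw [b0] at l0 u0
  rw [b1] at l1 u1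
  rw [b2] at l2 u2
  rw [b3] at l3 u3
  rw [b0, b1, b2, b3] at ht
  unfold octantWeight at ht
  rw [ne_eq, ite_eq_right_iff, not_forall] at ht
  obtain ⟨ht, -⟩ := ht
  have mem : ∀ x : Fin 3 → ℝ, 0 ≤ x 0 → 0 ≤ x 1 → 0 ≤ x 2 → x 0 + x 1 + x 2 ≤ 1 →
      x ∈ solidSimplex 3 1 := fun x hx hy hz hs =>
    ⟨fun i => by fin_cases i <;> assumption, by rw [Fin.sum_univ_three]; exact hs⟩
  rcases ht with ⟨e1, e2, e3⟩ | ⟨e1, e2, e3⟩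
  -- In this octant any two of `t 0`, `t 1`, `t 2` sum to less than `1`, while all three sum to at
  -- least `1`.
  · refine ⟨0, 1, by decide, ?_, ?_, ?_, ?_, ?_⟩
    · rw [octantMap_zero, octantMap_one]
      funext i
      fin_cases i <;> simp <;> ring
    · rw [octantMap_zero]
      apply mem <;> simp only [Matrix.cons_val] <;> linarith
    · rw [octantMap_one]
      apply mem <;> simp only [Matrix.cons_val] <;> linarith
    · obtain ⟨c0, c1, c2, c3⟩ := bary_three (octantMap 0 t)
      change bary 1 (octantMap 0 t) 1 < bary 1 (octantMap 0 t) 2 ∧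
        bary 1 (octantMap 0 t) 2 < bary 1 (octantMap 0 t) 0 + bary 1 (octantMap 0 t) 1
      rw [c0, c1, c2, octantMap_zero]
      simp only [Matrix.cons_val]
      constructor <;> linarith
    · obtain ⟨c0, c1, c2, c3⟩ := bary_three (octantMap 1 t)
      change bary 1 (octantMap 1 t) 2 + bary 1 (octantMap 1 t) 3 < bary 1 (octantMap 1 t) 0
      rw [c0, c2, c3, octantMap_one]
      simp only [Matrix.cons_val]
      linarith
  -- In this octant any two of `t 0`, `t 1`, `t 2` sum to more than `1`, hence exceed the third; the
  -- two summands are cyclic shifts of the half-differences.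
  · have cone : ∀ x : Fin 3 → ℝ, 1 - (x 0 + x 1 + x 2) < x 0 → 1 - (x 0 + x 1 + x 2) < x 1 →
        1 - (x 0 + x 1 + x 2) < x 2 → bary 1 x ∈ facetCone := fun x hx hy hz => by
      obtain ⟨c0, c1, c2, c3⟩ := bary_three x
      change bary 1 x 0 < bary 1 x 1 ∧ bary 1 x 0 < bary 1 x 2 ∧ bary 1 x 0 < bary 1 x 3
      rw [c0, c1, c2, c3]
      exact ⟨hx, hy, hz⟩
    refine ⟨2, 3, by decide, ?_, ?_, ?_, ?_, ?_⟩
    · rw [octantMap_two, octantMap_three]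
      funext i
      fin_cases i <;> simp <;> ring
    · rw [octantMap_two]
      apply mem <;> simp only [Matrix.cons_val] <;> linarith
    · rw [octantMap_three]
      apply mem <;> simp only [Matrix.cons_val] <;> linarith
    · refine cone _ ?_ ?_ ?_ <;> rw [octantMap_two] <;> simp only [Matrix.cons_val] <;> linarith
    · refine cone _ ?_ ?_ ?_ <;> rw [octantMap_three] <;> simp only [Matrix.cons_val] <;> linarith

/-- The two wedges contribute at most `12` and each copy of the cone at most `6`. Since there are
`24` permutations, the images cover the simplex at most once on average. -/
theorem sum_octantImage_le {q : Fin 4 → ℝ} (hq : ∀ i, 0 ≤ q i) :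
    ∑ π : Equiv.Perm (Fin 4), ∑ a,
      (octantImage a).indicator (1 : (Fin 4 → ℝ) → ℝ) (fun i => q (π i)) ≤ 24 := by
  rw [Finset.sum_comm, Fin.sum_univ_four]
  have h1 := sum_indicator_wedges_le hq
  have h2 := sum_indicator_facetCone_le q
  simp only [octantImage, Matrix.cons_val]
  linarith

theorem measurableSet_octantImage (a : Fin 4) : MeasurableSet (octantImage a) := by
  fin_cases a
  exacts [measurableSet_wedgeA, measurableSet_wedgeB, measurableSet_facetCone,
    measurableSet_facetCone]

/-- The splitting is averaged over all relabellings of the four coordinates. Almost every point is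
counted `6` times, each affine map contributes the inverse determinant `2`, and the images cover at
most `24` times: `6 ∫ G ≤ 2 * 24 ∫ F`. -/
theorem slabBound_octahedron : SlabBound 3 2 8 := by
  intro F G hF hFi hGi h
  set Fh := (solidSimplex 3 1).indicator F with hFh
  have hm := measurableSet_solidSimplex 3 1
  have hFhi : Integrable Fh := (integrable_indicator_iff hm).2 hFi
  have hFh0 : ∀ x, 0 ≤ Fh x := fun x => Set.indicator_nonneg hF x
  set φ : Equiv.Perm (Fin 4) → Fin 4 → (Fin 3 → ℝ) → ℝ := fun π a r =>
    (octantImage a).indicator (1 : (Fin 4 → ℝ) → ℝ) (bary 1 (octantMap a (permMap 2 π r))) *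
      Fh (permMap 1 π⁻¹ (octantMap a (permMap 2 π r))) with hφ
  set ψ : Equiv.Perm (Fin 4) → Fin 4 → (Fin 3 → ℝ) → ℝ := fun π a s =>
    (octantImage a).indicator (1 : (Fin 4 → ℝ) → ℝ) (fun i => bary 1 s (π i)) * Fh s with hψ
  have hI := fun π a => integral_weight_comp_affine (det_octantMatrix a) (octantShift a) π
    (measurableSet_octantImage a) hFhi
  have hφi : ∀ π a, Integrable (φ π a) := fun π a => (hI π a).1
  have hψi : ∀ π a, Integrable (ψ π a) := fun π a => (hI π a).2.1
  have hφψ : ∀ π a, ∫ r, φ π a r = 2 * ∫ s, ψ π a s := fun π a => (hI π a).2.2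
  have hφ0 : ∀ π a r, 0 ≤ φ π a r := fun π a r =>
    mul_nonneg (Set.indicator_nonneg (fun _ _ => zero_le_one) _) (hFh0 _)
  have hpt : ∀ r ∈ slab 3 2, ∀ π : Equiv.Perm (Fin 4),
      octantWeight (bary 2 r (π 0)) (bary 2 r (π 1)) (bary 2 r (π 2)) (bary 2 r (π 3)) * G r ≤
        ∑ a, φ π a r := by
    intro r hr π
    have hb : ∀ i, bary 2 (permMap 2 π r) i = bary 2 r (π i) := fun i =>
      congrFun (bary_permMap 2 π r) i
    by_cases h0 : octantWeight (bary 2 r (π 0)) (bary 2 r (π 1)) (bary 2 r (π 2)) (bary 2 r (π 3))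
      = 0
    · rw [h0, zero_mul]
      exact Finset.sum_nonneg fun a _ => hφ0 π a r
    have hone : octantWeight (bary 2 r (π 0)) (bary 2 r (π 1)) (bary 2 r (π 2))
        (bary 2 r (π 3)) = 1 := by
      unfold octantWeight at h0 ⊢
      rw [ite_eq_right_iff, not_forall] at h0
      exact if_pos h0.1
    rw [hone, one_mul]
    simp only [← hb] at h0
    obtain ⟨a, b, hab, hsum, ha, hb', hia, hib⟩ := octantMap_spec
      (fun i => by rw [hb]; exact (bary_two_mem_Icc hr _).1)
      (fun i => by rw [hb]; exact (bary_two_mem_Icc hr _).2) h0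
    have hr' := permMap_inv_add π hsum
    have hxa := permMap_mem_solidSimplex π⁻¹ ha
    have hxb := permMap_mem_solidSimplex π⁻¹ hb'
    have hG := h ![permMap 1 π⁻¹ (octantMap a (permMap 2 π r)),
      permMap 1 π⁻¹ (octantMap b (permMap 2 π r))]
      (fun i => by fin_cases i <;> assumption) (by rw [Fin.sum_univ_two]; simpa [hr'] using hr)
    rw [Fin.sum_univ_two, Fin.sum_univ_two] at hG
    simp only [Matrix.cons_val_zero, Matrix.cons_val_one, hr'] at hG
    have ea : φ π a r = F (permMap 1 π⁻¹ (octantMap a (permMap 2 π r))) := by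
      simp only [hφ, hFh, Set.indicator_of_mem hia, Set.indicator_of_mem hxa, Pi.one_apply, one_mul]
    have eb : φ π b r = F (permMap 1 π⁻¹ (octantMap b (permMap 2 π r))) := by
      simp only [hφ, hFh, Set.indicator_of_mem hib, Set.indicator_of_mem hxb, Pi.one_apply, one_mul]
    rw [← ea, ← eb, ← Finset.sum_pair (f := fun c => φ π c r) hab] at hG
    exact hG.trans (Finset.sum_le_sum_of_subset_of_nonneg (Finset.subset_univ _)
      fun c _ _ => hφ0 π c r)
  have hae : ∀ᵐ r ∂volume.restrict (slab 3 2), 6 * G r ≤ ∑ π, ∑ a, φ π a r := by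
    have hne : ∀ᵐ r : Fin 3 → ℝ, ∀ i j, i ≠ j → bary 2 r i + bary 2 r j ≠ 1 := by
      simp only [ae_all_iff]
      exact fun i j hij => ae_bary_add_ne 2 i j hij
    filter_upwards [ae_restrict_mem (measurableSet_slab 3 2), ae_restrict_of_ae hne] with r hr hr2
    rw [← sum_octantWeight (sum_bary 2 r) hr2, Finset.sum_mul]
    exact Finset.sum_le_sum fun π _ => hpt r hr π
  have hΦi : Integrable fun r => ∑ π, ∑ a, φ π a r :=
    integrable_finsetSum _ fun π _ => integrable_finsetSum _ fun a _ => hφi π a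
  have h48 : ∫ r in slab 3 2, 6 * G r ≤ 48 * ∫ x in solidSimplex 3 1, F x := by
    calc ∫ r in slab 3 2, 6 * G r ≤ ∫ r in slab 3 2, ∑ π, ∑ a, φ π a r :=
          integral_mono_ae (hGi.const_mul 6) hΦi.integrableOn hae
      _ ≤ ∫ r, ∑ π, ∑ a, φ π a r := setIntegral_le_integral hΦi
          (Filter.Eventually.of_forall fun r => Finset.sum_nonneg fun π _ =>
            Finset.sum_nonneg fun a _ => hφ0 π a r)
      _ = 2 * ∫ s, ∑ π, ∑ a, ψ π a s := by
          rw [integral_finsetSum _ fun π _ => integrable_finsetSum _ fun a _ => hφi π a,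
            integral_finsetSum _ fun π _ => integrable_finsetSum _ fun a _ => hψi π a,
            Finset.mul_sum]
          refine Finset.sum_congr rfl fun π _ => ?_
          rw [integral_finsetSum _ fun a _ => hφi π a, integral_finsetSum _ fun a _ => hψi π a,
            Finset.mul_sum]
          exact Finset.sum_congr rfl fun a _ => hφψ π a
      _ ≤ 2 * ∫ s, 24 * Fh s := by
          refine mul_le_mul_of_nonneg_left (integral_mono
            (integrable_finsetSum _ fun π _ => integrable_finsetSum _ fun a _ => hψi π a)
            (hFhi.const_mul 24) fun s => ?_) zero_le_two
          by_cases hs : s ∈ solidSimplex 3 1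
          · simp only [hψ, ← Finset.sum_mul]
            exact mul_le_mul_of_nonneg_right
              (sum_octantImage_le (mem_solidSimplex_one_iff.1 hs)) (hFh0 s)
          · simp [hψ, hFh, hs]
      _ = 48 * ∫ x in solidSimplex 3 1, F x := by
          rw [integral_const_mul, hFh, integral_indicator hm]
          ring
  rw [integral_const_mul] at h48
  linarith

/-! ### The inequality on the standard simplex -/

/-- The origin is also a vertex, so it fills the unused places when `∑ i, m i < s`. -/
theorem exists_vertices_sum {k : ℕ} (s : ℕ) (m : Fin k → ℕ) (hm : ∑ i, m i ≤ s) :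
    ∃ y : Fin s → Fin k → ℝ, (∀ i, y i = 0 ∨ ∃ l, y i = Pi.single l 1) ∧ ∑ i, y i = natVec m := by
  induction s generalizing m with
  | zero =>
    refine ⟨fun i => i.elim0, fun i => i.elim0, ?_⟩
    have h := Finset.sum_eq_zero_iff.1 (Nat.le_zero.1 hm)
    funext i
    simp [natVec, h i]
  | succ s ih =>
    by_cases h : ∑ i, m i ≤ s
    · obtain ⟨y, hy, hs⟩ := ih m h
      refine ⟨Fin.cons 0 y, fun i => Fin.cases (Or.inl rfl) hy i, ?_⟩
      rw [Fin.sum_univ_succ]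
      simpa using hs
    · obtain ⟨l, -, hl⟩ : ∃ l ∈ Finset.univ, m l ≠ 0 := by
        by_contra! h0
        exact h (by rw [Finset.sum_eq_zero h0]; exact Nat.zero_le _)
      have hsum : m = Function.update m l (m l - 1) + Pi.single l 1 := by
        funext i
        by_cases hi : i = l
        · subst hi; simp; omega
        · simp [hi]
      have hm' : ∑ i, Function.update m l (m l - 1) i ≤ s := by
        have := congrArg (fun f : Fin k → ℕ => ∑ i, f i) hsum
        simp only [Pi.add_apply, Finset.sum_add_distrib, Finset.sum_pi_single', Finset.mem_univ,
          if_true] at this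
        omega
      obtain ⟨y, hy, hs⟩ := ih _ hm'
      refine ⟨Fin.cons (Pi.single l 1) y, fun i => Fin.cases (Or.inr ⟨l, rfl⟩) hy i, ?_⟩
      rw [Fin.sum_univ_succ]
      simp only [Fin.cons_zero, Fin.cons_succ, hs]
      funext i
      conv_rhs => rw [hsum]
      by_cases hi : i = l
      · subst hi; simp [natVec, add_comm]
      · simp [natVec, hi]

theorem smul_solidSimplex {k n : ℕ} (hn : 1 ≤ n) :
    (n : ℝ)⁻¹ • solidSimplex k n = solidSimplex k 1 := by
  have hn' : (0 : ℝ) < n := by exact_mod_cast hn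
  ext t
  rw [Set.mem_inv_smul_set_iff₀ hn'.ne']
  simp only [solidSimplex, Set.mem_ofPred_eq, Pi.smul_apply, smul_eq_mul, ← Finset.mul_sum,
    mul_nonneg_iff_of_pos_left hn']
  rw [mul_le_iff_le_one_right hn']

theorem setIntegral_smul_solidSimplex {k n : ℕ} (hn : 1 ≤ n) (φ : (Fin k → ℝ) → ℝ) :
    ∫ t in solidSimplex k n, φ ((n : ℝ)⁻¹ • t) = (n : ℝ) ^ k * ∫ t in solidSimplex k 1, φ t := by
  have hn' : (0 : ℝ) < n := by exact_mod_cast hn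
  rw [Measure.setIntegral_comp_smul_of_pos _ _ _ (inv_pos.2 hn'), smul_solidSimplex hn]
  simp

theorem integrableOn_smul_solidSimplex {k n : ℕ} (hn : 1 ≤ n) {φ : (Fin k → ℝ) → ℝ}
    (h : IntegrableOn φ (solidSimplex k 1)) :
    IntegrableOn (fun t => φ ((n : ℝ)⁻¹ • t)) (solidSimplex k n) := by
  have hn' : (0 : ℝ) < n := by exact_mod_cast hn
  have h1 := (integrable_indicator_iff (measurableSet_solidSimplex k 1)).2 h
  have h2 := h1.comp_smul (inv_pos.2 hn').ne'
  refine (h2.integrableOn (s := solidSimplex k n)).congr_fun (fun t ht => ?_)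
    (measurableSet_solidSimplex k n)
  refine Set.indicator_of_mem ?_ _
  rw [← smul_solidSimplex hn]
  exact Set.smul_mem_smul_set ht

theorem mem_corners_integrableOn {k n : ℕ} {φ : (Fin k → ℝ) → ℝ}
    (h : IntegrableOn φ (solidSimplex k n)) {j : ℕ} (hj : j ≤ k) {m : Fin k → ℕ}
    (hm : m ∈ corners k n j) : IntegrableOn (fun r => φ (natVec m + r)) (slab k j) := by
  refine integrableOn_piece ⟨j, m⟩ (h.mono_set ?_)
  rw [solidSimplex_eq_biUnion]
  exact Set.subset_biUnion_of_mem (u := fun p : (Σ _ : ℕ, Fin k → ℕ) =>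
    (fun t : Fin k → ℝ => t - natVec p.2) ⁻¹' slab k p.1) (x := ⟨j, m⟩)
    (by
      change (⟨j, m⟩ : Σ _ : ℕ, Fin k → ℕ) ∈ pieceIndex k n
      simp only [pieceIndex, Finset.mem_sigma, Finset.mem_range]
      exact ⟨Nat.lt_succ_of_le hj, hm⟩)

theorem setIntegral_solidSimplex_eq_sum_Icc {k : ℕ} (hk : 1 ≤ k) (n : ℕ) {φ : (Fin k → ℝ) → ℝ}
    (h : IntegrableOn φ (solidSimplex k n)) :
    ∫ t in solidSimplex k n, φ t =
      ∑ j ∈ Finset.Icc 1 k, ∑ m ∈ corners k n j, ∫ r in slab k j, φ (natVec m + r) := by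
  rw [setIntegral_solidSimplex k n h, eq_comm]
  refine Finset.sum_subset (fun j hj => ?_) fun j hj hj' => Finset.sum_eq_zero fun m _ => ?_
  · simp only [Finset.mem_Icc, Finset.mem_range] at hj ⊢
    omega
  · obtain rfl : j = 0 := by
      simp only [Finset.mem_Icc, Finset.mem_range] at hj hj'
      omega
    exact setIntegral_measure_zero _ (volume_slab_zero hk)

/-- On a piece of level `j` with corner `m`, use `n - j` of the `n` points as vertices adding up to
`m`. They cost nothing because `F` vanishes there, so only the splitting of the slab point into `j`
points matters, and that is what the slab bound controls. -/
theorem setIntegral_solidSimplex_le {k n : ℕ} (hk : 1 ≤ k) (hn : 1 ≤ n) (B : ℕ → ℝ)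
    (hB : ∀ j, 1 ≤ j → j ≤ k → SlabBound k j (B j)) {F G : (Fin k → ℝ) → ℝ}
    (hF : ∀ x ∈ solidSimplex k 1, 0 ≤ F x) (hFi : IntegrableOn F (solidSimplex k 1))
    (hF0 : F 0 = 0) (hF1 : ∀ l, F (Pi.single l 1) = 0) (hGi : IntegrableOn G (solidSimplex k 1))
    (h : ∀ x : Fin n → Fin k → ℝ, (∀ i, x i ∈ solidSimplex k 1) →
      G ((n : ℝ)⁻¹ • ∑ i, x i) ≤ (∑ i, F (x i)) / n) :
    (n : ℝ) ^ (k + 1) * ∫ t in solidSimplex k 1, G t ≤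
      (∑ j ∈ Finset.Icc 1 k, (corners k n j).card * B j) * ∫ t in solidSimplex k 1, F t := by
  have hn' : (0 : ℝ) < n := by exact_mod_cast hn
  have hGi' := integrableOn_smul_solidSimplex hn hGi
  have hmain : ∀ j, 1 ≤ j → j ≤ k → ∀ m ∈ corners k n j,
      n * ∫ r in slab k j, G ((n : ℝ)⁻¹ • (natVec m + r)) ≤ B j * ∫ t in solidSimplex k 1, F t := by
    intro j hj1 hjk m hm
    rw [← integral_const_mul]
    refine hB j hj1 hjk F _ hF hFi ((mem_corners_integrableOn hGi' hjk hm).const_mul _) ?_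
    intro x hx _
    have hm' := mem_corners.1 hm
    obtain ⟨s, rfl⟩ : ∃ s, n = j + s := ⟨n - j, by omega⟩
    obtain ⟨y, hy, hys⟩ := exists_vertices_sum s m (by omega)
    have hyF : ∀ i, F (y i) = 0 := fun i => by
      rcases hy i with h0 | ⟨l, hl⟩
      · rw [h0, hF0]
      · rw [hl, hF1]
    have hyΔ : ∀ i, y i ∈ solidSimplex k 1 := fun i => by
      rcases hy i with h0 | ⟨l, hl⟩
      · rw [h0]; exact ⟨fun _ => le_rfl, by simp⟩
      · rw [hl]
        refine ⟨fun i => ?_, by simp⟩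
        rw [Pi.single_apply]
        split_ifs <;> norm_num
    have := h (Fin.append x y) (fun i => by
      refine Fin.addCases (fun i => ?_) (fun i => ?_) i
      · rw [Fin.append_left]; exact hx i
      · rw [Fin.append_right]; exact hyΔ i)
    simp only [Fin.sum_univ_add, Fin.append_left, Fin.append_right, hyF, hys,
      Finset.sum_const_zero, add_zero] at this
    rw [le_div_iff₀ hn', mul_comm, add_comm (∑ i, x i)] at this
    exact this
  calc (n : ℝ) ^ (k + 1) * ∫ t in solidSimplex k 1, G t
      = n * ∫ t in solidSimplex k n, G ((n : ℝ)⁻¹ • t) := by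
        rw [setIntegral_smul_solidSimplex hn]; ring
    _ = ∑ j ∈ Finset.Icc 1 k, ∑ m ∈ corners k n j,
          n * ∫ r in slab k j, G ((n : ℝ)⁻¹ • (natVec m + r)) := by
        rw [setIntegral_solidSimplex_eq_sum_Icc hk n hGi']
        simp only [Finset.mul_sum]
    _ ≤ ∑ j ∈ Finset.Icc 1 k, ∑ m ∈ corners k n j, B j * ∫ t in solidSimplex k 1, F t :=
        Finset.sum_le_sum fun j hj => Finset.sum_le_sum fun m hm =>
          hmain j (Finset.mem_Icc.1 hj).1 (Finset.mem_Icc.1 hj).2 m hm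
    _ = _ := by
        rw [Finset.sum_mul]
        exact Finset.sum_congr rfl fun j _ => by rw [Finset.sum_const, nsmul_eq_mul]; ring

theorem cast_choose_two_add (s : ℕ) : ((2 + s).choose s : ℝ) = (s + 1) * (s + 2) / 2 := by
  rw [← Nat.choose_symm_add]
  induction s with
  | zero => simp
  | succ s ih =>
    rw [← add_assoc, Nat.choose_succ_succ' (2 + s) 1, Nat.choose_one_right]
    push_cast
    rw [ih]
    ring

theorem cast_choose_three_add (s : ℕ) :
    ((3 + s).choose s : ℝ) = (s + 1) * (s + 2) * (s + 3) / 6 := by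
  rw [← Nat.choose_symm_add]
  induction s with
  | zero => norm_num
  | succ s ih =>
    have h := cast_choose_two_add (s + 1)
    rw [← Nat.choose_symm_add, ← add_assoc, add_right_comm] at h
    rw [← add_assoc, Nat.choose_succ_succ' (3 + s) 2]
    push_cast at h ⊢
    rw [ih, h]
    ring

theorem card_corners_one {n : ℕ} (hn : 1 ≤ n) : ((corners 1 n 1).card : ℝ) = n := by
  obtain ⟨s, rfl⟩ := Nat.exists_eq_add_of_le hn
  rw [card_corners, ← Nat.choose_symm_add]
  simp

/-- The polynomial also covers `j > n`, where there are no corners: it has a root at `n - j = -1`.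
The three-dimensional count works in the same way, with roots at `-1` and `-2`. -/
theorem card_corners_two (n j : ℕ) (hn : 1 ≤ n) (hj1 : 1 ≤ j) (hj : j ≤ 2) :
    ((corners 2 n j).card : ℝ) = ((n : ℝ) - j + 1) * (n - j + 2) / 2 := by
  rcases le_or_gt j n with h | h
  · obtain ⟨s, rfl⟩ := Nat.exists_eq_add_of_le h
    rw [card_corners, cast_choose_two_add]
    push_cast
    ring
  · obtain ⟨rfl, rfl⟩ : n = 1 ∧ j = 2 := by omega
    rw [corners_eq_empty h]
    norm_num

theorem card_corners_three (n j : ℕ) (hn : 1 ≤ n) (hj1 : 1 ≤ j) (hj : j ≤ 3) :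
    ((corners 3 n j).card : ℝ) = ((n : ℝ) - j + 1) * (n - j + 2) * (n - j + 3) / 6 := by
  rcases le_or_gt j n with h | h
  · obtain ⟨s, rfl⟩ := Nat.exists_eq_add_of_le h
    rw [card_corners, cast_choose_three_add]
    push_cast
    ring
  · rw [corners_eq_empty h]
    obtain ⟨rfl, rfl⟩ | ⟨rfl, rfl⟩ | ⟨rfl, rfl⟩ :
      (n = 1 ∧ j = 2) ∨ (n = 1 ∧ j = 3) ∨ (n = 2 ∧ j = 3) := by omega
    all_goals norm_num

/-- The number of unit simplices in the slab of level `j` of the `k`-dimensional cube, for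
`1 ≤ j ≤ k ≤ 3`. -/
def eulerian (k j : ℕ) : ℝ := if k = 3 ∧ j = 2 then 4 else 1

theorem slabBound_eulerian {k j : ℕ} (hk : k ≤ 3) (hj : 1 ≤ j) (hjk : j ≤ k) :
    SlabBound k j (j * eulerian k j) := by
  by_cases h : k = 3 ∧ j = 2
  · obtain ⟨rfl, rfl⟩ := h
    convert slabBound_octahedron using 1
    norm_num [eulerian]
  · rw [eulerian, if_neg h, mul_one]
    obtain rfl | rfl : j = 1 ∨ j = k := by omega
    · simpa using slabBound_one k
    · exact slabBound_top j

theorem Icc_one_two : Finset.Icc 1 2 = ({1, 2} : Finset ℕ) := by decide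

theorem Icc_one_three : Finset.Icc 1 3 = ({1, 2, 3} : Finset ℕ) := by decide

/-- This polynomial identity in `n` is where the sharp constants come from. -/
theorem sum_card_corners_mul {k n : ℕ} (hk : 1 ≤ k) (hk3 : k ≤ 3) (hn : 1 ≤ n) :
    ∑ j ∈ Finset.Icc 1 k, ((corners k n j).card : ℝ) * (j * eulerian k j) =
      (n : ℝ) ^ (k + 1) * (1 - sharpConst k n) := by
  have hn' : (n : ℝ) ≠ 0 := by positivity
  obtain rfl | rfl | rfl : k = 1 ∨ k = 2 ∨ k = 3 := by omega
  · simp only [Finset.Icc_self, Finset.sum_singleton, card_corners_one hn, eulerian, sharpConst]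
    norm_num
    field_simp
    ring
  · rw [Icc_one_two, Finset.sum_pair (by decide), card_corners_two n 1 hn le_rfl (by decide),
      card_corners_two n 2 hn (by decide) le_rfl]
    simp only [eulerian, sharpConst]
    norm_num
    field_simp
    ring
  · rw [Icc_one_three, Finset.sum_insert (by decide), Finset.sum_pair (by decide),
      card_corners_three n 1 hn le_rfl (by decide), card_corners_three n 2 hn (by decide)
        (by decide),
      card_corners_three n 3 hn (by decide) le_rfl]
    simp only [eulerian, sharpConst]
    norm_num
    field_simp
    ring

theorem solidSimplex_inequality {k n : ℕ} (hk : 1 ≤ k) (hk3 : k ≤ 3) (hn : 1 ≤ n)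
    {F G : (Fin k → ℝ) → ℝ}
    (hF : ∀ x ∈ solidSimplex k 1, 0 ≤ F x) (hFi : IntegrableOn F (solidSimplex k 1))
    (hF0 : F 0 = 0) (hF1 : ∀ l, F (Pi.single l 1) = 0) (hGi : IntegrableOn G (solidSimplex k 1))
    (h : ∀ x : Fin n → Fin k → ℝ, (∀ i, x i ∈ solidSimplex k 1) →
      G ((n : ℝ)⁻¹ • ∑ i, x i) ≤ (∑ i, F (x i)) / n) :
    ∫ t in solidSimplex k 1, G t ≤ (1 - sharpConst k n) * ∫ t in solidSimplex k 1, F t := by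
  have hn' : (0 : ℝ) < (n : ℝ) ^ (k + 1) := by positivity
  have := setIntegral_solidSimplex_le hk hn (fun j => j * eulerian k j)
    (fun j hj hjk => slabBound_eulerian hk3 hj hjk) hF hFi hF0 hF1 hGi h
  rw [sum_card_corners_mul hk hk3 hn, mul_assoc] at this
  exact le_of_mul_le_mul_left this hn'

/-! ### Volumes of the slabs -/

theorem volume_slab_counting {k n : ℕ} (hk : 1 ≤ k) (hn : 1 ≤ n) :
    (n : ℝ) ^ k * volume.real (solidSimplex k 1) =
      ∑ j ∈ Finset.Icc 1 k, ((corners k n j).card : ℝ) * volume.real (slab k j) := by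
  have hfin : volume (solidSimplex k n) ≠ ⊤ := (isCompact_solidSimplex k n).measure_lt_top.ne
  have h1 := setIntegral_smul_solidSimplex (k := k) hn fun _ => (1 : ℝ)
  have h2 := setIntegral_solidSimplex_eq_sum_Icc hk n (φ := fun _ => (1 : ℝ))
    (integrableOn_const hfin)
  rw [h2] at h1
  simpa using h1.symm

/-- Counting the pieces of the simplex dilated by `1, …, k` gives a triangular linear system for the
slab volumes, since the level of a piece is at most the dilation factor. -/
theorem volume_slab {k j : ℕ} (hk3 : k ≤ 3) (hj : 1 ≤ j) (hjk : j ≤ k) :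
    volume.real (slab k j) = eulerian k j * volume.real (solidSimplex k 1) := by
  obtain rfl | rfl | rfl : k = 1 ∨ k = 2 ∨ k = 3 := by omega
  · obtain rfl : j = 1 := by omega
    have h1 := volume_slab_counting (k := 1) le_rfl (n := 1) le_rfl
    rw [Finset.Icc_self, Finset.sum_singleton, card_corners_one le_rfl] at h1
    norm_num [eulerian] at h1 ⊢
    linarith
  · have h1 := volume_slab_counting (k := 2) (by decide) (n := 1) le_rfl
    have h2 := volume_slab_counting (k := 2) (by decide) (n := 2) (by decide)
    rw [Icc_one_two, Finset.sum_pair (by decide), card_corners_two _ 1 (by decide)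
      le_rfl (by decide),
      card_corners_two _ 2 (by decide) (by decide) le_rfl] at h1 h2
    obtain rfl | rfl : j = 1 ∨ j = 2 := by omega
    all_goals
      norm_num [eulerian] at h1 h2 ⊢
      linarith
  · have h1 := volume_slab_counting (k := 3) (by decide) (n := 1) le_rfl
    have h2 := volume_slab_counting (k := 3) (by decide) (n := 2) (by decide)
    have h3 := volume_slab_counting (k := 3) (by decide) (n := 3) (by decide)
    rw [Icc_one_three, Finset.sum_insert (by decide), Finset.sum_pair (by decide),
      card_corners_three _ 1 (by decide) le_rfl (by decide),
      card_corners_three _ 2 (by decide) (by decide) (by decide),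
      card_corners_three _ 3 (by decide) (by decide) le_rfl] at h1 h2 h3
    obtain rfl | rfl | rfl : j = 1 ∨ j = 2 ∨ j = 3 := by omega
    all_goals
      norm_num [eulerian] at h1 h2 h3 ⊢
      linarith

/-- The part without `j` is the volume of the dilated simplex; the part with `j` is the sum that
defines `1 - sharpConst k n`. -/
theorem sum_card_corners_volume {k n : ℕ} (hk : 1 ≤ k) (hk3 : k ≤ 3) (hn : 1 ≤ n) :
    ∑ j ∈ Finset.Icc 1 k, ((corners k n j).card : ℝ) *
      (volume.real (slab k j) * (((n : ℝ) - j) / n)) =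
      (n : ℝ) ^ k * (sharpConst k n * volume.real (solidSimplex k 1)) := by
  have hn' : (n : ℝ) ≠ 0 := by positivity
  have h1 := volume_slab_counting hk hn
  have h2 := sum_card_corners_mul hk hk3 hn
  have h3 : ∑ j ∈ Finset.Icc 1 k, ((corners k n j).card : ℝ) *
      (volume.real (slab k j) * (((n : ℝ) - j) / n)) =
      ∑ j ∈ Finset.Icc 1 k, ((corners k n j).card : ℝ) * volume.real (slab k j) -
      (∑ j ∈ Finset.Icc 1 k, ((corners k n j).card : ℝ) * (j * eulerian k j)) / n *
        volume.real (solidSimplex k 1) := by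
    rw [Finset.sum_div, Finset.sum_mul, ← Finset.sum_sub_distrib]
    refine Finset.sum_congr rfl fun j hj => ?_
    rw [volume_slab hk3 (Finset.mem_Icc.1 hj).1 (Finset.mem_Icc.1 hj).2]
    field_simp
  rw [h3, h2, ← h1]
  field_simp
  ring

/-! ### Transfer to arbitrary simplices -/

/-- Barycentric coordinates with respect to `v`, with the first coordinate omitted. -/
noncomputable def chart {k : ℕ} (v : Fin (k + 1) → Space k) (t : Fin k → ℝ) : Space k :=
  ∑ i, bary 1 t i • v i

/-- Families of points with unique barycentric coordinates. -/
def UniqueBary {k : ℕ} (v : Fin (k + 1) → Space k) : Prop :=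
  ∀ w : Fin (k + 1) → ℝ, ∑ i, w i = 0 → ∑ i, w i • v i = 0 → w = 0

theorem bary_add {k : ℕ} (c d : ℝ) (x y : Fin k → ℝ) (i : Fin (k + 1)) :
    bary (c + d) (x + y) i = bary c x i + bary d y i :=
  Fin.cases (by simp [Finset.sum_add_distrib]; ring) (fun i => by simp) i

theorem bary_smul {k : ℕ} (a c : ℝ) (x : Fin k → ℝ) (i : Fin (k + 1)) :
    bary (a * c) (a • x) i = a * bary c x i :=
  Fin.cases (by simp [Finset.mul_sum, mul_sub]) (fun i => by simp) i

theorem bary_tail {k : ℕ} {c : ℝ} {w : Fin (k + 1) → ℝ} (h : ∑ i, w i = c) :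
    bary c (fun i => w i.succ) = w := by
  rw [Fin.sum_univ_succ] at h
  funext i
  refine Fin.cases ?_ (fun i => rfl) i
  rw [bary_zero]
  linarith

theorem exists_chart_equiv {k : ℕ} {v : Fin (k + 1) → Space k} (hv : UniqueBary v) :
    ∃ L : (Fin k → ℝ) ≃L[ℝ] Space k, ∀ t, chart v t = L t + v 0 := by
  let L : (Fin k → ℝ) →ₗ[ℝ] Space k :=
    { toFun := fun t => ∑ i, bary 0 t i • v i
      map_add' := fun x y => by
        rw [← Finset.sum_add_distrib]
        refine Finset.sum_congr rfl fun i _ => ?_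
        rw [← add_smul, ← bary_add, add_zero]
      map_smul' := fun a x => by
        rw [RingHom.id_apply, Finset.smul_sum]
        refine Finset.sum_congr rfl fun i _ => ?_
        rw [smul_smul, ← bary_smul, mul_zero] }
  have hL : Function.Injective L := by
    rw [← LinearMap.ker_eq_bot, LinearMap.ker_eq_bot']
    intro t ht
    have := hv (bary 0 t) (sum_bary 0 t) ht
    funext i
    exact congrFun this i.succ
  refine ⟨(LinearMap.linearEquivOfInjective L hL (by simp)).toContinuousLinearEquiv, fun t => ?_⟩
  change ∑ i, bary 1 t i • v i = ∑ i, bary 0 t i • v i + v 0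
  have h : ∀ i, bary 1 t i = bary 0 t i + bary 1 0 i := fun i => by
    rw [← bary_add, zero_add, add_zero]
  simp only [h, add_smul, Finset.sum_add_distrib, Fin.sum_univ_succ (fun i => bary 1 0 i • v i)]
  simp

theorem chart_injective {k : ℕ} {v : Fin (k + 1) → Space k} (hv : UniqueBary v) :
    Function.Injective (chart v) := by
  obtain ⟨L, hL⟩ := exists_chart_equiv hv
  intro x y h
  rw [hL, hL] at h
  exact L.injective (add_right_cancel h)

theorem measurableEmbedding_chart {k : ℕ} {v : Fin (k + 1) → Space k} (hv : UniqueBary v) :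
    MeasurableEmbedding (chart v) := by
  obtain ⟨L, hL⟩ := exists_chart_equiv hv
  rw [show chart v = (fun x => x + v 0) ∘ L from funext hL]
  exact (MeasurableEquiv.addRight (v 0)).measurableEmbedding.comp L.toHomeomorph.measurableEmbedding

/-- The value of the factor is irrelevant: it multiplies both sides of every inequality and identity
that is transferred. -/
theorem exists_map_chart_volume {k : ℕ} {v : Fin (k + 1) → Space k} (hv : UniqueBary v) :
    ∃ c : NNReal, 0 < c ∧ Measure.map (chart v) volume = c • volume := by
  obtain ⟨L, hL⟩ := exists_chart_equiv hv
  refine ⟨Measure.addHaarScalarFactor (Measure.map L volume) volume,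
    Measure.addHaarScalarFactor_pos_of_isAddHaarMeasure _ _, ?_⟩
  rw [show chart v = (fun x => x + v 0) ∘ L from funext hL,
    ← Measure.map_map (measurable_add_const _) L.continuous.measurable]
  conv_lhs => rw [Measure.isAddLeftInvariant_eq_smul (Measure.map L volume) volume]
  rw [Measure.map_smul, (measurePreserving_add_right volume (v 0)).map_eq]

theorem image_chart {k : ℕ} (v : Fin (k + 1) → Space k) :
    chart v '' solidSimplex k 1 = convexHull ℝ (Set.range v) := by
  apply Set.Subset.antisymm
  · rintro _ ⟨t, ht, rfl⟩
    exact mem_convexHull_of_exists_fintype (bary 1 t) v (mem_solidSimplex_one_iff.1 ht)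
      (sum_bary 1 t) (fun i => Set.mem_range_self i) rfl
  · refine convexHull_min ?_ ?_
    · rintro _ ⟨i, rfl⟩
      have h : bary 1 (fun l : Fin k => (Pi.single i 1 : Fin (k + 1) → ℝ) l.succ) = Pi.single i 1 :=
        bary_tail (by simp)
      refine ⟨fun l => (Pi.single i 1 : Fin (k + 1) → ℝ) l.succ, ?_, ?_⟩
      · rw [mem_solidSimplex_one_iff, h]
        intro l
        rw [Pi.single_apply]
        split_ifs <;> norm_num
      · rw [chart, h]
        simp [Pi.single_apply]
    · rintro _ ⟨x, hx, rfl⟩ _ ⟨y, hy, rfl⟩ a b ha hb hab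
      have h : ∀ i, bary 1 (a • x + b • y) i = a * bary 1 x i + b * bary 1 y i := fun i => by
        rw [← bary_smul, ← bary_smul, ← bary_add, ← add_mul, hab, one_mul]
      refine ⟨a • x + b • y, ?_, ?_⟩
      · rw [mem_solidSimplex_one_iff] at hx hy ⊢
        intro i
        rw [h]
        have := hx i
        have := hy i
        positivity
      · simp only [chart, h, add_smul, Finset.sum_add_distrib, Finset.smul_sum, mul_smul]

theorem preimage_chart {k : ℕ} {v : Fin (k + 1) → Space k} (hv : UniqueBary v) :
    chart v ⁻¹' convexHull ℝ (Set.range v) = solidSimplex k 1 := by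
  rw [← image_chart, (chart_injective hv).preimage_image]

theorem integrableOn_chart_iff {k : ℕ} {v : Fin (k + 1) → Space k} (hv : UniqueBary v)
    {φ : Space k → ℝ} : IntegrableOn φ (convexHull ℝ (Set.range v)) ↔
      IntegrableOn (fun t => φ (chart v t)) (solidSimplex k 1) := by
  obtain ⟨c, hc, hmap⟩ := exists_map_chart_volume hv
  have h := (measurableEmbedding_chart hv).integrableOn_map_iff (f := φ) (μ := volume)
    (s := convexHull ℝ (Set.range v))
  rw [preimage_chart hv, hmap] at h
  refine Iff.trans ?_ h
  rw [IntegrableOn, IntegrableOn, Measure.restrict_smul]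
  exact (integrable_smul_measure (ENNReal.coe_ne_zero.2 hc.ne') ENNReal.coe_ne_top).symm

theorem exists_setIntegral_chart {k : ℕ} {v : Fin (k + 1) → Space k} (hv : UniqueBary v) :
    ∃ c : ℝ, 0 < c ∧ ∀ φ : Space k → ℝ, ∫ x in convexHull ℝ (Set.range v), φ x =
      c * ∫ t in solidSimplex k 1, φ (chart v t) := by
  obtain ⟨c, hc, hmap⟩ := exists_map_chart_volume hv
  refine ⟨(c : ℝ)⁻¹, by positivity, fun φ => ?_⟩
  have h := (measurableEmbedding_chart hv).setIntegral_map (μ := volume) φ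
    (convexHull ℝ (Set.range v))
  rw [preimage_chart hv, hmap, Measure.restrict_smul, integral_smul_nnreal_measure] at h
  rw [← h, NNReal.smul_def, smul_eq_mul, inv_mul_cancel_left₀]
  exact_mod_cast hc.ne'

theorem chart_average {k n : ℕ} (hn : 1 ≤ n) (v : Fin (k + 1) → Space k) (x : Fin n → Fin k → ℝ) :
    chart v ((n : ℝ)⁻¹ • ∑ i, x i) = (n : ℝ)⁻¹ • ∑ i, chart v (x i) := by
  have hn' : (n : ℝ) ≠ 0 := by positivity
  have h : ∀ l, bary 1 ((n : ℝ)⁻¹ • ∑ i, x i) l = (n : ℝ)⁻¹ * ∑ i, bary 1 (x i) l := by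
    intro l
    refine Fin.cases ?_ (fun l => ?_) l
    · simp only [bary_zero, Pi.smul_apply, Finset.sum_apply, smul_eq_mul, Finset.sum_sub_distrib,
        ← Finset.mul_sum]
      rw [Finset.sum_comm, mul_sub]
      simp [hn']
    · simp
  simp only [chart, h, mul_smul, Finset.sum_smul, ← Finset.smul_sum]
  rw [Finset.sum_comm]

theorem simplex_inequality {k n : ℕ} (hk : 1 ≤ k) (hk3 : k ≤ 3) (hn : 1 ≤ n)
    {v : Fin (k + 1) → Space k} (hv : UniqueBary v) {F G : Space k → ℝ}
    (hF : ∀ x ∈ convexHull ℝ (Set.range v), 0 ≤ F x)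
    (hFi : IntegrableOn F (convexHull ℝ (Set.range v))) (hFv : ∀ i, F (v i) = 0)
    (hGi : IntegrableOn G (convexHull ℝ (Set.range v)))
    (h : ∀ x : Fin n → Space k, (∀ i, x i ∈ convexHull ℝ (Set.range v)) →
      G ((n : ℝ)⁻¹ • ∑ i, x i) ≤ (∑ i, F (x i)) / n) :
    ∫ x in convexHull ℝ (Set.range v), G x ≤
      (1 - sharpConst k n) * ∫ x in convexHull ℝ (Set.range v), F x := by
  obtain ⟨c, hc, hint⟩ := exists_setIntegral_chart hv
  have hmem : ∀ t ∈ solidSimplex k 1, chart v t ∈ convexHull ℝ (Set.range v) := fun t ht => by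
    rw [← image_chart]
    exact Set.mem_image_of_mem _ ht
  rw [hint, hint, mul_left_comm]
  refine mul_le_mul_of_nonneg_left ?_ hc.le
  refine solidSimplex_inequality hk hk3 hn (fun t ht => hF _ (hmem t ht))
    ((integrableOn_chart_iff hv).1 hFi) ?_ (fun l => ?_) ((integrableOn_chart_iff hv).1 hGi)
    fun x hx => ?_
  · convert hFv 0
    simp [chart, Fin.sum_univ_succ]
  · convert hFv l.succ
    rw [chart, Fin.sum_univ_succ]
    simp [Pi.single_apply]
  · rw [chart_average hn]
    exact h _ fun i => hmem _ (hx i)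

/-! ### Concave envelopes of functions on sets -/

/-- The convex hull of the graph of `f` on `A`. -/
def graphHull {k : ℕ} (A : Set (Space k)) (f : Space k → ℝ) : Set (Space k × ℝ) :=
  convexHull ℝ ((fun x => (x, f x)) '' A)

/-- The concave envelope of `f` on the convex hull of `A`. -/
noncomputable def envelope {k : ℕ} (A : Set (Space k)) (f : Space k → ℝ) (z : Space k) : ℝ :=
  sSup {t | (z, t) ∈ graphHull A f}

section envelope

variable {k : ℕ} {A B C : Set (Space k)} {f g : Space k → ℝ} {M : ℝ} {z : Space k} {t : ℝ}

theorem graphHull_mono (h : A ⊆ B) : graphHull A f ⊆ graphHull B f :=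
  convexHull_mono (Set.image_mono h)

theorem mem_convexHull_of_mem_graphHull (h : (z, t) ∈ graphHull A f) : z ∈ convexHull ℝ A := by
  have h1 : graphHull A f ⊆ (LinearMap.fst ℝ (Space k) ℝ) ⁻¹' convexHull ℝ A := by
    refine convexHull_min ?_ ((convex_convexHull ℝ A).linear_preimage _)
    rintro _ ⟨x, hx, rfl⟩
    exact subset_convexHull ℝ A hx
  exact h1 h

theorem exists_mem_graphHull (h : z ∈ convexHull ℝ A) : ∃ t, (z, t) ∈ graphHull A f := by
  have h1 : convexHull ℝ A ⊆ (LinearMap.fst ℝ (Space k) ℝ) '' graphHull A f := by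
    refine convexHull_min (fun x hx => ⟨(x, f x), subset_convexHull ℝ _ ⟨x, hx, rfl⟩, rfl⟩) ?_
    exact (convex_convexHull ℝ _).linear_image _
  obtain ⟨⟨x, t⟩, hx, rfl⟩ := h1 h
  exact ⟨t, hx⟩

theorem le_of_mem_graphHull (hg : ConcaveOn ℝ C g) (hA : A ⊆ C) (hfg : ∀ x ∈ A, f x ≤ g x)
    (h : (z, t) ∈ graphHull A f) : t ≤ g z := by
  have h1 : graphHull A f ⊆ {p : Space k × ℝ | p.1 ∈ C ∧ p.2 ≤ g p.1} := by
    refine convexHull_min ?_ hg.convex_hypograph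
    rintro _ ⟨x, hx, rfl⟩
    exact ⟨hA hx, hfg x hx⟩
  exact (h1 h).2

theorem abs_le_of_mem_graphHull (hf : ∀ x ∈ A, |f x| ≤ M) (h : (z, t) ∈ graphHull A f) :
    |t| ≤ M := by
  have h1 : graphHull A f ⊆ (LinearMap.snd ℝ (Space k) ℝ) ⁻¹' Set.Icc (-M) M := by
    refine convexHull_min ?_ ((convex_Icc _ _).linear_preimage _)
    rintro _ ⟨x, hx, rfl⟩
    exact abs_le.1 (hf x hx)
  exact abs_le.2 (h1 h)

theorem bddAbove_graphHull (hf : ∀ x ∈ A, |f x| ≤ M) : BddAbove {t | (z, t) ∈ graphHull A f} :=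
  ⟨M, fun _ ht => (abs_le.1 (abs_le_of_mem_graphHull hf ht)).2⟩

theorem le_envelope (hf : ∀ x ∈ A, |f x| ≤ M) (h : (z, t) ∈ graphHull A f) :
    t ≤ envelope A f z := le_csSup (bddAbove_graphHull hf) h

theorem self_le_envelope (hf : ∀ x ∈ A, |f x| ≤ M) (h : z ∈ A) : f z ≤ envelope A f z :=
  le_envelope hf (subset_convexHull ℝ _ ⟨z, h, rfl⟩)

theorem envelope_le (h : z ∈ convexHull ℝ A) {b : ℝ} (hb : ∀ t, (z, t) ∈ graphHull A f → t ≤ b) :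
    envelope A f z ≤ b := csSup_le (exists_mem_graphHull h) hb

theorem abs_envelope_le (hf : ∀ x ∈ A, |f x| ≤ M) (h : z ∈ convexHull ℝ A) :
    |envelope A f z| ≤ M := by
  obtain ⟨t, ht⟩ := exists_mem_graphHull (f := f) h
  refine abs_le.2 ⟨(abs_le.1 (abs_le_of_mem_graphHull hf ht)).1.trans (le_envelope hf ht), ?_⟩
  exact envelope_le h fun t ht => (abs_le.1 (abs_le_of_mem_graphHull hf ht)).2

theorem envelope_mono (hf : ∀ x ∈ B, |f x| ≤ M) (h : A ⊆ B) (hz : z ∈ convexHull ℝ A) :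
    envelope A f z ≤ envelope B f z :=
  envelope_le hz fun _ ht => le_envelope hf (graphHull_mono h ht)

theorem exists_mem_graphHull_gt (h : z ∈ convexHull ℝ A) {b : ℝ} (hb : b < envelope A f z) :
    ∃ t, (z, t) ∈ graphHull A f ∧ b < t := exists_lt_of_lt_csSup (exists_mem_graphHull h) hb

theorem concaveOn_envelope (hf : ∀ x ∈ A, |f x| ≤ M) :
    ConcaveOn ℝ (convexHull ℝ A) (envelope A f) := by
  refine ⟨convex_convexHull ℝ A, fun x hx y hy a b ha hb hab => ?_⟩
  refine le_of_forall_pos_le_add fun ε hε => ?_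
  obtain ⟨s, hs, hs'⟩ := exists_mem_graphHull_gt hx (sub_lt_self (envelope A f x) hε)
  obtain ⟨t, ht, ht'⟩ := exists_mem_graphHull_gt hy (sub_lt_self (envelope A f y) hε)
  have h1 : (a • x + b • y, a • s + b • t) ∈ graphHull A f :=
    (convex_convexHull ℝ _ : Convex ℝ (graphHull A f)) hs ht ha hb hab
  have h2 := le_envelope hf h1
  simp only [smul_eq_mul] at h2 ⊢
  have h3 : a * (envelope A f x - ε) + b * (envelope A f y - ε) ≤ a * s + b * t := by gcongr
  have h4 : a * ε + b * ε = ε := by rw [← add_mul, hab, one_mul]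
  linarith

/-- The envelope is itself a concave majorant. Conversely, the hypograph of any concave majorant is
convex and contains the graph of `f`, hence its hull. -/
theorem concaveHull_eq_envelope (hC : Convex ℝ C) (hf : ∀ x ∈ C, |f x| ≤ M) (hz : z ∈ C) :
    concaveHull C f z = envelope C f z := by
  have hz' : z ∈ convexHull ℝ C := subset_convexHull ℝ C hz
  apply le_antisymm
  · refine csInf_le ⟨f z, ?_⟩ ⟨envelope C f, ?_, fun x hx => self_le_envelope hf hx, rfl⟩
    · rintro _ ⟨g, -, hg, rfl⟩
      exact hg z hz
    · have := concaveOn_envelope hf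
      rwa [hC.convexHull_eq] at this
  · refine le_csInf ⟨M, fun _ => M, concaveOn_const M hC, fun x hx => (abs_le.1 (hf x hx)).2,
    rfl⟩ ?_
    rintro _ ⟨g, hg, hfg, rfl⟩
    exact envelope_le hz' fun t ht => le_of_mem_graphHull hg le_rfl hfg ht

theorem interior_ae_eq_of_convex (hC : Convex ℝ C) : interior C =ᵐ[volume] C := by
  refine Filter.EventuallyLE.antisymm interior_subset.eventuallyLE ?_
  rw [ae_le_set]
  refine measure_mono_null (fun x hx => ?_) (hC.addHaar_frontier volume)
  exact ⟨subset_closure hx.1, hx.2⟩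

/-- A concave function is continuous on the interior, and the boundary of a convex set is null. -/
theorem aestronglyMeasurable_of_concaveOn (hg : ConcaveOn ℝ C g) :
    AEStronglyMeasurable g (volume.restrict C) := by
  rw [← Measure.restrict_congr_set (interior_ae_eq_of_convex hg.1)]
  exact hg.continuousOn_interior.aestronglyMeasurable isOpen_interior.measurableSet

theorem graphHull_iUnion {P : ℕ → Set (Space k)} (hP : Monotone P) :
    graphHull (⋃ m, P m) f ⊆ ⋃ m, graphHull (P m) f := by
  refine convexHull_min ?_ ?_
  · rintro _ ⟨x, hx, rfl⟩
    obtain ⟨m, hm⟩ := Set.mem_iUnion.1 hx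
    exact Set.mem_iUnion.2 ⟨m, subset_convexHull ℝ _ ⟨x, hm, rfl⟩⟩
  · refine Directed.convex_iUnion (Monotone.directed_le fun a b h => graphHull_mono (hP h))
      fun {m} => convex_convexHull ℝ _

/-- Each point of the graph hull of an increasing union already lies in the hull of one member, so
the envelopes increase to the full supremum. -/
theorem tendsto_envelope_iUnion {P : ℕ → Set (Space k)} (hP : Monotone P)
    (hf : ∀ x ∈ ⋃ m, P m, |f x| ≤ M) (hz : z ∈ convexHull ℝ (⋃ m, P m)) :
    (∀ᶠ m in Filter.atTop, z ∈ convexHull ℝ (P m)) ∧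
      Filter.Tendsto (fun m => envelope (P m) f z) Filter.atTop (𝓝 (envelope (⋃ m, P m) f z)) := by
  have key : ∀ b < envelope (⋃ m, P m) f z, ∀ᶠ m in Filter.atTop,
      z ∈ convexHull ℝ (P m) ∧ b < envelope (P m) f z := by
    intro b hb
    obtain ⟨t, ht, hbt⟩ := exists_mem_graphHull_gt hz hb
    obtain ⟨m, hm⟩ := Set.mem_iUnion.1 (graphHull_iUnion hP ht)
    filter_upwards [Filter.eventually_ge_atTop m] with m' hm'
    have h1 := graphHull_mono (f := f) (hP hm') hm
    exact ⟨mem_convexHull_of_mem_graphHull h1,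
      hbt.trans_le (le_envelope (fun x hx => hf x (Set.mem_iUnion.2 ⟨m', hx⟩)) h1)⟩
  have h1 : ∀ᶠ m in Filter.atTop, z ∈ convexHull ℝ (P m) :=
    (key _ (sub_one_lt _)).mono fun m h => h.1
  refine ⟨h1, tendsto_order.2 ⟨fun b hb => (key b hb).mono fun m h => h.2, fun b hb => ?_⟩⟩
  filter_upwards [h1] with m hm
  exact (envelope_mono hf (Set.subset_iUnion P m) hm).trans_lt hb

theorem exists_finset_graphHull (h : (z, t) ∈ graphHull A f) :
    ∃ Q : Finset (Space k), (Q : Set (Space k)) ⊆ A ∧ (z, t) ∈ graphHull (Q : Set (Space k)) f := by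
  classical
  unfold graphHull at h
  rw [convexHull_eq_union_convexHull_finite_subsets] at h
  simp only [Set.mem_iUnion] at h
  obtain ⟨T, hT, hmem⟩ := h
  refine ⟨T.image Prod.fst, ?_, convexHull_mono ?_ hmem⟩
  · intro x hx
    obtain ⟨p, hp, rfl⟩ := Finset.mem_image.1 (Finset.mem_coe.1 hx)
    obtain ⟨y, hy, rfl⟩ := hT hp
    exact hy
  · intro p hp
    obtain ⟨y, hy, rfl⟩ := hT hp
    exact ⟨y, by simpa using ⟨_, hp⟩, rfl⟩

/-- The affine span of `A` is closed, so it contains the open set `interior C` and is the whole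
space if that set is nonempty. The hull then has interior points, and a convex set with interior
points has the same interior as its closure. -/
theorem interior_subset_convexHull_of_dense (hA : interior C ⊆ closure (convexHull ℝ A)) :
    interior C ⊆ interior (convexHull ℝ A) := by
  rcases (interior C).eq_empty_or_nonempty with h0 | h0
  · rw [h0]; exact Set.empty_subset _
  have hK := convex_convexHull ℝ A
  have htop : affineSpan ℝ A = ⊤ := by
    have h1 : interior C ⊆ (affineSpan ℝ A : Set (Space k)) :=
      hA.trans (closure_minimal (convexHull_subset_affineSpan A)
        (AffineSubspace.closed_of_finiteDimensional _))
    have h2 : affineSpan ℝ (interior C) ≤ affineSpan ℝ A := affineSpan_le.2 h1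
    rw [isOpen_interior.affineSpan_eq_top h0] at h2
    exact top_le_iff.1 h2
  rw [← hK.interior_closure_eq_interior_of_nonempty_interior
    (interior_convexHull_nonempty_iff_affineSpan_eq_top.2 htop)]
  exact interior_maximal hA isOpen_interior

/-- For each interior point of a countable dense sequence and each precision, finitely many points
of `C` witness the envelope there. Collecting these gives a set whose envelope agrees with that of
`C` on a dense subset of the interior, hence on all of it by continuity. -/
theorem exists_finset_approximation (hC : Convex ℝ C) (hf : ∀ x ∈ C, |f x| ≤ M) :
    ∃ P : ℕ → Finset (Space k), (∀ m, (P m : Set (Space k)) ⊆ C) ∧ ∀ z ∈ interior C,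
      (∀ᶠ m in Filter.atTop, z ∈ convexHull ℝ (P m : Set (Space k))) ∧
      Filter.Tendsto (fun m => envelope (P m : Set (Space k)) f z) Filter.atTop
        (𝓝 (envelope C f z)) := by
  classical
  set u := TopologicalSpace.denseSeq (Space k)
  have hQ : ∀ i j : ℕ, ∃ Q : Finset (Space k), (Q : Set (Space k)) ⊆ C ∧ (u i ∈ interior C →
      ∃ t, (u i, t) ∈ graphHull (Q : Set (Space k)) f ∧ envelope C f (u i) - 1 / ((j : ℝ) + 1) < t)
        := by
    intro i j
    by_cases hi : u i ∈ interior C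
    · obtain ⟨t, ht, ht'⟩ := exists_mem_graphHull_gt (f := f)
        (subset_convexHull ℝ C (interior_subset hi))
        (sub_lt_self (envelope C f (u i)) (Nat.one_div_pos_of_nat (n := j)))
      obtain ⟨Q, hQC, hQ⟩ := exists_finset_graphHull ht
      exact ⟨Q, hQC, fun _ => ⟨t, hQ, ht'⟩⟩
    · exact ⟨∅, by simp, fun h => absurd h hi⟩
  choose Q hQC hQ using hQ
  set P : ℕ → Finset (Space k) := fun m =>
    (Finset.range m ×ˢ Finset.range m).biUnion fun p => Q p.1 p.2 with hP
  have hPC : ∀ m, (P m : Set (Space k)) ⊆ C := by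
    intro m x hx
    obtain ⟨p, -, hp⟩ := Finset.mem_biUnion.1 (Finset.mem_coe.1 hx)
    exact hQC _ _ hp
  have hmono : Monotone fun m => (P m : Set (Space k)) := by
    intro a b hab
    refine Finset.coe_subset.2 (Finset.biUnion_subset_biUnion_of_subset_left _ ?_)
    exact Finset.product_subset_product (Finset.range_mono hab) (Finset.range_mono hab)
  set A := ⋃ m, (P m : Set (Space k)) with hA
  have hAC : A ⊆ C := Set.iUnion_subset hPC
  have hQA : ∀ i j, (Q i j : Set (Space k)) ⊆ A := by
    intro i j x hx
    refine Set.mem_iUnion.2 ⟨max i j + 1, Finset.mem_coe.2 (Finset.mem_biUnion.2 ⟨(i, j), ?_, hx⟩)⟩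
    simp only [Finset.mem_product, Finset.mem_range]
    omega
  have hfA : ∀ x ∈ A, |f x| ≤ M := fun x hx => hf x (hAC hx)
  set D := interior C ∩ Set.range u with hD
  have hDA : D ⊆ convexHull ℝ A := by
    rintro _ ⟨hi, i, rfl⟩
    obtain ⟨t, ht, -⟩ := hQ i 0 hi
    exact convexHull_mono (hQA i 0) (mem_convexHull_of_mem_graphHull ht)
  have hDd : interior C ⊆ closure D :=
    (TopologicalSpace.denseRange_denseSeq (Space k)).open_subset_closure_inter isOpen_interior
  have hint : interior C ⊆ interior (convexHull ℝ A) :=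
    interior_subset_convexHull_of_dense (hDd.trans (closure_mono hDA))
  have hEq : Set.EqOn (envelope A f) (envelope C f) (interior C) := by
    refine Set.EqOn.of_subset_closure (s := D) ?_
      ((concaveOn_envelope hfA).continuousOn_interior.mono hint) ?_ Set.inter_subset_left hDd
    · intro x hx
      refine le_antisymm (envelope_mono hf hAC (hDA hx)) ?_
      obtain ⟨hi, i, rfl⟩ := hx
      refine le_of_forall_pos_le_add fun ε hε => ?_
      obtain ⟨j, hj⟩ := exists_nat_one_div_lt hε
      obtain ⟨t, ht, ht'⟩ := hQ i j hi
      have := le_envelope hfA (graphHull_mono (hQA i j) ht)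
      linarith
    · have := (concaveOn_envelope hf).continuousOn_interior
      rwa [hC.convexHull_eq] at this
  refine ⟨P, hPC, fun z hz => ?_⟩
  rw [← hEq hz]
  exact tendsto_envelope_iUnion hmono hfA (interior_subset (hint hz))

end envelope

/-! ### Triangulations induced by generic heights -/

theorem affineSpan_image_ne_top {k : ℕ} {ι : Type*} {p : ι → Space k} {S : Finset ι}
    (hS : S.card ≤ k) :
    affineSpan ℝ (p '' S) ≠ ⊤ := by
  classical
  intro htop
  rcases S.eq_empty_or_nonempty with rfl | hne
  · simp at htop
  have h1 := finrank_vectorSpan_image_finset_le ℝ p S (n := S.card - 1)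
    (by have := hne.card_pos; omega)
  have h2 : vectorSpan ℝ (p '' (S : Set ι)) = ⊤ := by
    rw [← direction_affineSpan, htop, AffineSubspace.direction_top]
  have h3 : Module.finrank ℝ (vectorSpan ℝ (p '' (S : Set ι))) = k := by
    rw [h2, finrank_top]; simp
  have h4 : Module.finrank ℝ (vectorSpan ℝ (S.image p : Set (Space k))) = k := by
    rw [Finset.coe_image]; exact h3
  have := hne.card_pos
  omega

/-- Weights on the image of `e` as weights on the whole index set. -/
noncomputable def pushWeights {k : ℕ} {ι : Type*} [DecidableEq ι] (e : Fin (k + 1) → ι)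
    (β : Fin (k + 1) → ℝ) (i : ι) : ℝ := ∑ a, if e a = i then β a else 0

theorem pushWeights_apply {k : ℕ} {ι : Type*} [DecidableEq ι] {e : Fin (k + 1) → ι}
    {β : Fin (k + 1) → ℝ} (he : Function.Injective e) (a : Fin (k + 1)) :
    pushWeights e β (e a) = β a := by
  simp [pushWeights, he.eq_iff]

theorem pushWeights_eq_zero {k : ℕ} {ι : Type*} [DecidableEq ι] {e : Fin (k + 1) → ι}
    {β : Fin (k + 1) → ℝ} {i : ι} (hi : i ∉ Finset.univ.image e) : pushWeights e β i = 0 := by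
  refine Finset.sum_eq_zero fun a _ => if_neg fun h => hi ?_
  rw [← h]
  exact Finset.mem_image_of_mem e (Finset.mem_univ a)

theorem pushWeights_comp_self {k : ℕ} {ι : Type*} [DecidableEq ι] {e : Fin (k + 1) → ι}
    {w : ι → ℝ} (he : Function.Injective e)
    (hw : ∀ i ∉ Finset.univ.image e, w i = 0) : pushWeights e (w ∘ e) = w := by
  funext i
  by_cases hi : i ∈ Finset.univ.image e
  · obtain ⟨a, -, rfl⟩ := Finset.mem_image.1 hi
    exact pushWeights_apply he a
  · rw [pushWeights_eq_zero hi, hw i hi]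

section triangulation

variable {k : ℕ} {ι : Type*} [Fintype ι] {p : ι → Space k} {h : ι → ℝ} {w u v : ι → ℝ}

/-- Weights for which the interpolated height over the point they represent is largest. -/
def OptimalWeights (p : ι → Space k) (h : ι → ℝ) (w : ι → ℝ) : Prop :=
  w ∈ stdSimplex ℝ ι ∧ ∀ u ∈ stdSimplex ℝ ι, ∑ i, u i • p i = ∑ i, w i • p i →
    ∑ i, u i * h i ≤ ∑ i, w i * h i

/-- No affinely dependent set of points lies, when lifted by the heights, over a dependence. -/
def GenericHeights (p : ι → Space k) (h : ι → ℝ) : Prop :=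
  ∀ S : Finset ι, (∃ μ : ι → ℝ, μ ≠ 0 ∧ (∀ i ∉ S, μ i = 0) ∧ ∑ i, μ i = 0 ∧ ∑ i, μ i • p i = 0) →
    ∃ μ : ι → ℝ, (∀ i ∉ S, μ i = 0) ∧ ∑ i, μ i = 0 ∧ ∑ i, μ i • p i = 0 ∧ ∑ i, μ i * h i ≠ 0

/-- For each dependent `S`, fix one dependence; the heights orthogonal to it form a proper subspace,
which is null. Almost every height vector avoids these finitely many subspaces, so one lies in the
open box below `f`. -/
theorem exists_genericHeights (p : ι → Space k) (f : ι → ℝ) {ε : ℝ} (hε : 0 < ε) :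
    ∃ h : ι → ℝ, GenericHeights p h ∧ ∀ i, h i ≤ f i ∧ f i - ε ≤ h i := by
  classical
  have hS : ∀ S : Finset ι, ∀ᵐ h : ι → ℝ,
      (∃ μ : ι → ℝ, μ ≠ 0 ∧ (∀ i ∉ S, μ i = 0) ∧ ∑ i, μ i = 0 ∧ ∑ i, μ i • p i = 0) →
      ∃ μ : ι → ℝ, (∀ i ∉ S, μ i = 0) ∧ ∑ i, μ i = 0 ∧ ∑ i, μ i • p i = 0 ∧ ∑ i, μ i * h i ≠ 0 := by
    intro S
    by_cases hex : ∃ μ : ι → ℝ, μ ≠ 0 ∧ (∀ i ∉ S, μ i = 0) ∧ ∑ i, μ i = 0 ∧ ∑ i, μ i • p i = 0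
    · obtain ⟨μ, hμ, hμS, hμ0, hμp⟩ := hex
      set L : (ι → ℝ) →ₗ[ℝ] ℝ := ∑ i, μ i • LinearMap.proj i with hL
      have hLa : ∀ h, L h = ∑ i, μ i * h i := fun h => by simp [hL]
      have hLne : LinearMap.ker L ≠ ⊤ := by
        intro htop
        apply hμ
        funext i
        have := hLa (Pi.single i 1)
        rw [LinearMap.ker_eq_top.1 htop] at this
        simpa [Pi.single_apply] using this.symm
      have h0 := Measure.addHaar_submodule volume _ hLne
      filter_upwards [measure_eq_zero_iff_ae_notMem.1 h0] with h hh _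
      refine ⟨μ, hμS, hμ0, hμp, fun h0 => hh ?_⟩
      rw [SetLike.mem_coe, LinearMap.mem_ker, hLa, h0]
    · exact Filter.Eventually.of_forall fun h h' => absurd h' hex
  have hd := Measure.dense_of_ae (ae_all_iff.2 hS)
  obtain ⟨h, hb, hg⟩ := hd.inter_open_nonempty (Set.univ.pi fun i => Set.Ioo (f i - ε) (f i))
    (isOpen_set_pi Set.finite_univ fun i _ => isOpen_Ioo)
    (Set.univ_pi_nonempty_iff.2 fun i => Set.nonempty_Ioo.2 (sub_lt_self _ hε))
  exact ⟨h, hg, fun i => ⟨(hb i trivial).2.le, (hb i trivial).1.le⟩⟩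

theorem exists_optimalWeights (p : ι → Space k) (h : ι → ℝ) {z : Space k}
    (hz : z ∈ convexHull ℝ (Set.range p)) : ∃ w, OptimalWeights p h w ∧ ∑ i, w i • p i = z := by
  set K := stdSimplex ℝ ι ∩ {w | ∑ i, w i • p i = z} with hK
  have hKc : IsCompact K := (isCompact_stdSimplex ℝ ι).inter_right
    (isClosed_eq (by fun_prop) continuous_const)
  have hKn : K.Nonempty := by
    have hsub : convexHull ℝ (Set.range p) ⊆
        (Fintype.linearCombination ℝ p) '' stdSimplex ℝ ι := by
      refine convexHull_min ?_ ((convex_stdSimplex ℝ ι).linear_image _)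
      rintro _ ⟨i, rfl⟩
      classical
      exact ⟨Pi.single i 1, single_mem_stdSimplex ℝ i,
        by simp [Fintype.linearCombination_apply_single]⟩
    obtain ⟨w, hw, hwz⟩ := hsub hz
    exact ⟨w, hw, by simpa [Fintype.linearCombination_apply] using hwz⟩
  obtain ⟨w, hw, hmax⟩ := hKc.exists_isMaxOn hKn
    (f := fun w => ∑ i, w i * h i) (by fun_prop)
  exact ⟨w, ⟨hw.1, fun u hu huw => hmax ⟨hu, huw.trans hw.2⟩⟩, hw.2⟩

theorem exists_pos_add_mul_nonneg (hw : ∀ i, 0 ≤ w i) {μ : ι → ℝ} (hμ : ∀ i, w i = 0 → 0 ≤ μ i) :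
    ∃ t : ℝ, 0 < t ∧ ∀ i, 0 ≤ w i + t * μ i := by
  have h1 : ∀ᶠ t : ℝ in 𝓝[>] 0, ∀ i, 0 ≤ w i + t * μ i := by
    rw [Filter.eventually_all]
    intro i
    rcases (hw i).eq_or_lt with h0 | h0
    · filter_upwards [self_mem_nhdsWithin] with t ht
      rw [← h0, zero_add]
      exact mul_nonneg (le_of_lt ht) (hμ i h0.symm)
    · have hc : Filter.Tendsto (fun t : ℝ => w i + t * μ i) (𝓝[>] 0) (𝓝 (w i + 0 * μ i)) :=
        ((continuous_const.add (continuous_id.mul continuous_const)).tendsto 0).mono_left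
          nhdsWithin_le_nhds
      rw [zero_mul, add_zero] at hc
      exact (hc.eventually (lt_mem_nhds h0)).mono fun t ht => ht.le
  obtain ⟨t, ht, ht'⟩ := (h1.and self_mem_nhdsWithin).exists
  exact ⟨t, ht', ht⟩

/-- First-order optimality: `μ` is negative only where `w` is positive, so a small step along it
remains feasible and cannot raise the height. -/
theorem OptimalWeights.sum_mul_nonpos (hw : OptimalWeights p h w) {μ : ι → ℝ}
    (hμ : ∀ i, w i = 0 → 0 ≤ μ i) (hμ0 : ∑ i, μ i = 0) (hμp : ∑ i, μ i • p i = 0) :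
    ∑ i, μ i * h i ≤ 0 := by
  obtain ⟨t, ht, hnn⟩ := exists_pos_add_mul_nonneg hw.1.1 hμ
  have h1 := hw.2 (fun i => w i + t * μ i)
    ⟨hnn, by rw [Finset.sum_add_distrib, ← Finset.mul_sum, hμ0, hw.1.2]; simp⟩
    (by simp only [add_smul, mul_smul, Finset.sum_add_distrib, ← Finset.smul_sum, hμp]; simp)
  simp only [add_mul, mul_assoc, Finset.sum_add_distrib, ← Finset.mul_sum] at h1
  by_contra! hpos
  have := mul_pos ht hpos
  linarith

/-- A dependence on the support may be followed in both directions, so it has height `0`. Genericity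
then leaves no nonzero one: the support is affinely independent. -/
theorem OptimalWeights.eq_zero_of_dependence (hw : OptimalWeights p h w) (hg : GenericHeights p h)
    {μ : ι → ℝ} (hμ : ∀ i, w i = 0 → μ i = 0) (hμ0 : ∑ i, μ i = 0) (hμp : ∑ i, μ i • p i = 0) :
    μ = 0 := by
  classical
  by_contra hne
  obtain ⟨ν, hν, hν0, hνp, hνh⟩ := hg (Finset.univ.filter fun i => w i ≠ 0)
    ⟨μ, hne, fun i hi => hμ i (by simpa using hi), hμ0, hμp⟩
  have hν' : ∀ i, w i = 0 → ν i = 0 := fun i hi => hν i (by simpa using hi)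
  have h1 := hw.sum_mul_nonpos (fun i hi => (hν' i hi).ge) hν0 hνp
  have h2 := hw.sum_mul_nonpos (μ := -ν) (fun i hi => by simp [hν' i hi]) (by simp [hν0])
    (by simp [hνp])
  simp only [Pi.neg_apply, neg_mul, Finset.sum_neg_distrib] at h2
  exact hνh (by linarith)

/-- The midpoint of two optima is optimal and its support contains both supports, so their
difference is a dependence on an affinely independent set. -/
theorem OptimalWeights.unique (hw : OptimalWeights p h w) (hu : OptimalWeights p h u)
    (hg : GenericHeights p h) (hwu : ∑ i, u i • p i = ∑ i, w i • p i) : u = w := by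
  have hmid : OptimalWeights p h fun i => 2⁻¹ * w i + 2⁻¹ * u i := by
    have hp : ∑ i, (2⁻¹ * w i + 2⁻¹ * u i) • p i = ∑ i, w i • p i := by
      simp only [add_smul, mul_smul, Finset.sum_add_distrib, ← Finset.smul_sum, hwu]
      rw [← add_smul]; norm_num
    have hh := le_antisymm (hu.2 w hw.1 hwu.symm) (hw.2 u hu.1 hwu)
    refine ⟨convex_stdSimplex ℝ ι hw.1 hu.1 (by norm_num) (by norm_num) (by norm_num),
      fun x hx hxp => ?_⟩
    have := hw.2 x hx (hxp.trans hp)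
    simp only [add_mul, mul_assoc, Finset.sum_add_distrib, ← Finset.mul_sum]
    linarith
  have := hmid.eq_zero_of_dependence hg (μ := u - w) (fun i hi => ?_)
    (by simp [Finset.sum_sub_distrib, hu.1.2, hw.1.2])
      (by simp [sub_smul, Finset.sum_sub_distrib, hwu])
  · exact sub_eq_zero.1 this
  · have := hw.1.1 i
    have := hu.1.1 i
    simp only [Pi.sub_apply]
    linarith

theorem OptimalWeights.of_support (hw : OptimalWeights p h w) (hv : v ∈ stdSimplex ℝ ι)
    (hs : ∀ i, w i = 0 → v i = 0) : OptimalWeights p h v := by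
  refine ⟨hv, fun u hu huv => ?_⟩
  have := hw.sum_mul_nonpos (μ := u - v) (fun i hi => by simp [hs i hi, hu.1 i])
    (by simp [Finset.sum_sub_distrib, hu.2, hv.2]) (by simp [sub_smul, Finset.sum_sub_distrib, huv])
  simp only [Pi.sub_apply, sub_mul, Finset.sum_sub_distrib] at this
  linarith

theorem ae_notMem_affineSpan (p : ι → Space k) :
    ∀ᵐ z : Space k, ∀ S : Finset ι, S.card ≤ k → z ∉ affineSpan ℝ (p '' S) := by
  rw [ae_all_iff]
  intro S
  by_cases hS : S.card ≤ k
  · filter_upwards [measure_eq_zero_iff_ae_notMem.1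
      (Measure.addHaar_affineSubspace volume _ (affineSpan_image_ne_top (p := p) hS))] with z hz _
    exact hz
  · exact Filter.Eventually.of_forall fun z h => absurd h hS

/-- With `card_support_le`, this forces exactly `k + 1` support points over almost every point of
the hull. -/
theorem lt_card_support {z : Space k} (hz : ∀ S : Finset ι, S.card ≤ k → z ∉ affineSpan ℝ (p '' S))
    (hw : w ∈ stdSimplex ℝ ι) (hwz : ∑ i, w i • p i = z) {S : Finset ι} (hS : ∀ i ∉ S, w i = 0) :
    k < S.card := by
  by_contra! hle
  refine hz S hle (convexHull_subset_affineSpan _ ?_)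
  have h1 : ∑ i ∈ S, w i = 1 := by
    rw [← hw.2]
    exact Finset.sum_subset (Finset.subset_univ _) fun i _ hi => hS i hi
  have h2 : ∑ i ∈ S, w i • p i = z := by
    rw [← hwz]
    exact Finset.sum_subset (Finset.subset_univ _) fun i _ hi => by rw [hS i hi, zero_smul]
  rw [← h2, ← Finset.centerMass_eq_of_sum_1 _ _ h1]
  exact Finset.centerMass_mem_convexHull _ (fun i _ => hw.1 i) (by rw [h1]; exact one_pos)
    fun i hi => ⟨i, hi, rfl⟩

theorem OptimalWeights.card_support_le [DecidableEq ι] (hw : OptimalWeights p h w)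
    (hg : GenericHeights p h) :
    (Finset.univ.filter fun i => w i ≠ 0).card ≤ k + 1 := by
  set S := Finset.univ.filter fun i => w i ≠ 0 with hS
  let ext : (S → ℝ) →ₗ[ℝ] (ι → ℝ) :=
    { toFun := fun μ i => if hi : i ∈ S then μ ⟨i, hi⟩ else 0
      map_add' := fun a b => by funext i; simp only [Pi.add_apply]; split_ifs <;> simp
      map_smul' := fun a b => by
        funext i
        simp only [Pi.smul_apply, RingHom.id_apply]
        split_ifs <;> simp }
  let T : (ι → ℝ) →ₗ[ℝ] ℝ × Space k :=
    (Fintype.linearCombination ℝ fun _ : ι => (1 : ℝ)).prod (Fintype.linearCombination ℝ p)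
  have hinj : Function.Injective (T ∘ₗ ext) := by
    rw [← LinearMap.ker_eq_bot, LinearMap.ker_eq_bot']
    intro μ hμ
    have h1 : ∑ i, ext μ i = 0 := by
      simpa [T, Fintype.linearCombination_apply] using congrArg Prod.fst hμ
    have h2 : ∑ i, ext μ i • p i = 0 := by
      simpa [T, Fintype.linearCombination_apply] using congrArg Prod.snd hμ
    have h3 := hw.eq_zero_of_dependence hg (μ := ext μ) (fun i hi => by simp [ext, hS, hi]) h1 h2
    funext i
    have := congrFun h3 i
    simpa [ext, i.2] using this
  have := LinearMap.finrank_le_finrank_of_injective hinj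
  simpa [add_comm] using this

section pushWeights

variable [DecidableEq ι] {e : Fin (k + 1) → ι} {β : Fin (k + 1) → ℝ}

theorem sum_pushWeights_smul {E : Type*} [AddCommGroup E] [Module ℝ E] (φ : ι → E) :
    ∑ i, pushWeights e β i • φ i = ∑ a, β a • φ (e a) := by
  simp only [pushWeights, Finset.sum_smul]
  rw [Finset.sum_comm]
  simp [ite_smul]

theorem sum_pushWeights : ∑ i, pushWeights e β i = ∑ a, β a := by
  simpa using sum_pushWeights_smul (e := e) (β := β) fun _ : ι => (1 : ℝ)

theorem pushWeights_mem_stdSimplex (h0 : ∀ a, 0 ≤ β a) (h1 : ∑ a, β a = 1) :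
    pushWeights e β ∈ stdSimplex ℝ ι := by
  refine ⟨fun i => Finset.sum_nonneg fun a _ => ?_, by rw [sum_pushWeights, h1]⟩
  split_ifs
  exacts [h0 a, le_rfl]

end pushWeights

/-- Points with generic heights are triangulated by simplices over each of which the heights are
interpolated by their concave envelope. -/
theorem exists_triangulation (p : ι → Space k) (f : ι → ℝ) {ε : ℝ} (hε : 0 < ε) :
    ∃ (h : ι → ℝ) (N : Finset (Fin (k + 1) → ι)),
      (∀ i, h i ≤ f i ∧ f i - ε ≤ h i) ∧ (∀ e ∈ N, UniqueBary (p ∘ e)) ∧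
      (∀ e ∈ N, ∀ t ∈ solidSimplex k 1, ∀ u ∈ stdSimplex ℝ ι, ∑ i, u i • p i = chart (p ∘ e) t →
        ∑ i, u i * h i ≤ ∑ i, bary 1 t i * h (e i)) ∧
      (Set.Pairwise (N : Set (Fin (k + 1) → ι)) (Function.onFun (AEDisjoint volume)
        fun e => convexHull ℝ (Set.range (p ∘ e)))) ∧
      convexHull ℝ (Set.range p) ≤ᵐ[volume] ⋃ e ∈ N, convexHull ℝ (Set.range (p ∘ e)) := by
  classical
  obtain ⟨h, hg, hhf⟩ := exists_genericHeights p f hε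
  set supp : (ι → ℝ) → Finset ι := fun w => Finset.univ.filter fun i => w i ≠ 0 with hsupp
  -- The cells are spanned by the supports of size `k + 1` of optimal weights, each enumerated once
  -- so that distinct indices have distinct vertex sets.
  set good : Finset (Finset ι) := Finset.univ.filter fun S => S.card = k + 1 ∧
    ∃ w, OptimalWeights p h w ∧ supp w = S with hgood
  have hmem : ∀ {S}, S ∈ good ↔ S.card = k + 1 ∧ ∃ w, OptimalWeights p h w ∧ supp w = S := by
    intro S; simp [hgood]
  set N : Finset (Fin (k + 1) → ι) := good.attach.image fun S =>
    fun a => ((S.1.equivFinOfCardEq (hmem.1 S.2).1).symm a : ι) with hN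
  have himage : ∀ (S : Finset ι) (hc : S.card = k + 1),
      Finset.univ.image (fun a => ((S.equivFinOfCardEq hc).symm a : ι)) = S := by
    intro S hc
    ext i
    simp only [Finset.mem_image, Finset.mem_univ, true_and]
    exact ⟨fun ⟨a, ha⟩ => ha ▸ ((S.equivFinOfCardEq hc).symm a).2,
      fun hi => ⟨S.equivFinOfCardEq hc ⟨i, hi⟩, by simp⟩⟩
  have hNinj : ∀ e ∈ N, Function.Injective e := by
    intro e he
    obtain ⟨S, -, rfl⟩ := Finset.mem_image.1 he
    exact Subtype.val_injective.comp (Equiv.injective _)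
  have hNgood : ∀ e ∈ N, Finset.univ.image e ∈ good := by
    intro e he
    obtain ⟨S, -, rfl⟩ := Finset.mem_image.1 he
    rw [himage]
    exact S.2
  have hNeq : ∀ e ∈ N, ∀ e' ∈ N, Finset.univ.image e = Finset.univ.image e' → e = e' := by
    intro e he e' he' heq
    obtain ⟨S, -, rfl⟩ := Finset.mem_image.1 he
    obtain ⟨S', -, rfl⟩ := Finset.mem_image.1 he'
    rw [himage, himage] at heq
    obtain rfl : S = S' := Subtype.ext heq
    rfl
  have hopt : ∀ e ∈ N, ∀ t ∈ solidSimplex k 1, OptimalWeights p h (pushWeights e (bary 1 t)) := by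
    intro e he t ht
    obtain ⟨-, w, hw, hwS⟩ := hmem.1 (hNgood e he)
    refine hw.of_support (pushWeights_mem_stdSimplex (mem_solidSimplex_one_iff.1 ht) (sum_bary 1 t))
      fun i hi => pushWeights_eq_zero ?_
    rw [← hwS]
    simp [hsupp, hi]
  refine ⟨h, N, hhf, fun e he => ?_, fun e he t ht u hu hut => ?_, fun e he e' he' hne => ?_, ?_⟩
  · intro β hβ0 hβp
    obtain ⟨-, w, hw, hwS⟩ := hmem.1 (hNgood e he)
    have h0 := hw.eq_zero_of_dependence hg (μ := pushWeights e β) (fun i hi => pushWeights_eq_zero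
      (by rw [← hwS]; simp [hsupp, hi])) (by rw [sum_pushWeights, hβ0])
      (by rw [sum_pushWeights_smul]; exact hβp)
    funext a
    rw [← pushWeights_apply (β := β) (hNinj e he) a, h0]
    rfl
  · have h1 := (hopt e he t ht).2 u hu (by rw [hut, sum_pushWeights_smul]; rfl)
    have h2 := sum_pushWeights_smul (e := e) (β := bary 1 t) h
    simp only [smul_eq_mul] at h2
    rwa [h2] at h1
  · change volume (_ ∩ _) = 0
    rw [measure_eq_zero_iff_ae_notMem]
    filter_upwards [ae_notMem_affineSpan p] with z hz
    rintro ⟨h1, h2⟩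
    rw [← image_chart] at h1 h2
    obtain ⟨t, ht, rfl⟩ := h1
    obtain ⟨t', ht', htt⟩ := h2
    have e1 : ∑ i, pushWeights e (bary 1 t) i • p i = chart (p ∘ e) t := sum_pushWeights_smul p
    have e2 : ∑ i, pushWeights e' (bary 1 t') i • p i = chart (p ∘ e') t' := sum_pushWeights_smul p
    -- Over a common point the optimal weights agree, so they live on the intersection of the two
    -- vertex sets. Off the exceptional null set it has more than `k` elements, so the two sets
    -- coincide.
    have heq := (hopt e he t ht).unique (hopt e' he' t' ht') hg (by rw [e1, e2, htt])
    have hcard := lt_card_support hz (hopt e he t ht).1 e1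
      (S := Finset.univ.image e ∩ Finset.univ.image e') fun i hi => by
        rw [Finset.mem_inter, not_and_or] at hi
        rcases hi with hi | hi
        · exact pushWeights_eq_zero hi
        · rw [← heq]
          exact pushWeights_eq_zero hi
    have c1 := (hmem.1 (hNgood e he)).1
    have c2 := (hmem.1 (hNgood e' he')).1
    apply hne
    refine hNeq e he e' he' ?_
    have i1 := Finset.eq_of_subset_of_card_le
      (Finset.inter_subset_left (s₁ := Finset.univ.image e) (s₂ := Finset.univ.image e')) (by omega)
    have i2 := Finset.eq_of_subset_of_card_le
      (Finset.inter_subset_right (s₁ := Finset.univ.image e) (s₂ := Finset.univ.image e'))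
        (by omega)
    exact i1.symm.trans i2
  · filter_upwards [ae_notMem_affineSpan p] with z hz hzp
    obtain ⟨w, hw, hwz⟩ := exists_optimalWeights p h hzp
    have hS0 : ∀ i ∉ supp w, w i = 0 := fun i hi => by simpa [hsupp] using hi
    have hc : (supp w).card = k + 1 := le_antisymm (hw.card_support_le hg)
      (lt_card_support hz hw.1 hwz hS0)
    have hSg : supp w ∈ good := hmem.2 ⟨hc, w, hw, rfl⟩
    set e : Fin (k + 1) → ι := fun a => (((supp w).equivFinOfCardEq hc).symm a : ι) with he
    have heN : e ∈ N := Finset.mem_image.2 ⟨⟨supp w, hSg⟩, Finset.mem_attach _ _, rfl⟩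
    have hpw := pushWeights_comp_self (hNinj e heN) (w := w) (by rw [he, himage]; exact hS0)
    refine Set.mem_iUnion₂.2 ⟨e, heN, ?_⟩
    refine mem_convexHull_of_exists_fintype (w ∘ e) (p ∘ e) (fun a => hw.1.1 _) ?_
      (fun a => Set.mem_range_self a) ?_
    · rw [← sum_pushWeights (e := e), hpw, hw.1.2]
    · rw [← hwz]
      conv_rhs => rw [← hpw]
      exact (sum_pushWeights_smul p).symm

end triangulation

/-! ### The inequality on a domain -/

theorem sharpConst_mem_Icc {k n : ℕ} (hk : 1 ≤ k) (hk3 : k ≤ 3) (hn : 1 ≤ n) :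
    0 ≤ sharpConst k n ∧ sharpConst k n ≤ 1 := by
  have hn' : (1 : ℝ) ≤ n := by exact_mod_cast hn
  have h0 : (0 : ℝ) < n := by linarith
  obtain rfl | rfl | rfl : k = 1 ∨ k = 2 ∨ k = 3 := by omega
  · simp only [sharpConst]
    exact ⟨div_nonneg (by linarith) h0.le, by rw [div_le_one h0]; linarith⟩
  · simp only [sharpConst]
    refine ⟨div_nonneg (mul_nonneg (by linarith) (by linarith)) (by positivity), ?_⟩
    rw [div_le_one (by positivity)]
    nlinarith
  · simp only [sharpConst]
    refine ⟨by positivity, ?_⟩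
    rw [div_le_one (by positivity)]
    nlinarith

/-- The affine function on the simplex with vertices `v` interpolating `η`. -/
noncomputable def interpolation {k : ℕ} (v : Fin (k + 1) → Space k) (η : Fin (k + 1) → ℝ)
    (x : Space k) : ℝ := ∑ i, bary 1 (Function.invFun (chart v) x) i * η i

theorem interpolation_chart {k : ℕ} {v : Fin (k + 1) → Space k} (hv : UniqueBary v)
    (η : Fin (k + 1) → ℝ) (t : Fin k → ℝ) :
    interpolation v η (chart v t) = ∑ i, bary 1 t i * η i := by
  rw [interpolation, Function.leftInverse_invFun (chart_injective hv) t]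

theorem interpolation_vertex {k : ℕ} {v : Fin (k + 1) → Space k} (hv : UniqueBary v)
    (η : Fin (k + 1) → ℝ) (i : Fin (k + 1)) : interpolation v η (v i) = η i := by
  have h : bary 1 (fun l : Fin k => (Pi.single i 1 : Fin (k + 1) → ℝ) l.succ) = Pi.single i 1 :=
    bary_tail (by simp)
  have h2 : chart v (fun l : Fin k => (Pi.single i 1 : Fin (k + 1) → ℝ) l.succ) = v i := by
    rw [chart, h]
    simp [Pi.single_apply]
  rw [← h2, interpolation_chart hv, h]
  simp [Pi.single_apply]

theorem integrableOn_interpolation {k : ℕ} {v : Fin (k + 1) → Space k} (hv : UniqueBary v)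
    (η : Fin (k + 1) → ℝ) :
    IntegrableOn (interpolation v η) (convexHull ℝ (Set.range v)) := by
  rw [integrableOn_chart_iff hv]
  simp only [interpolation_chart hv]
  refine ContinuousOn.integrableOn_compact (isCompact_solidSimplex k 1) (Continuous.continuousOn ?_)
  simp only [Fin.sum_univ_succ, bary_zero, bary_succ]
  fun_prop

theorem interpolation_average {k n : ℕ} (hn : 1 ≤ n) {v : Fin (k + 1) → Space k} (hv : UniqueBary v)
    (η : Fin (k + 1) → ℝ) {x : Fin n → Space k} (hx : ∀ i, x i ∈ convexHull ℝ (Set.range v)) :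
    interpolation v η ((n : ℝ)⁻¹ • ∑ i, x i) = (∑ i, interpolation v η (x i)) / n := by
  have hn' : (n : ℝ) ≠ 0 := by positivity
  have hx' : ∀ i, ∃ t, chart v t = x i := fun i => by
    have := hx i
    rw [← image_chart] at this
    obtain ⟨t, -, ht⟩ := this
    exact ⟨t, ht⟩
  choose t ht using hx'
  obtain rfl : x = fun i => chart v (t i) := funext fun i => (ht i).symm
  simp only [← chart_average hn, interpolation_chart hv]
  have h : ∀ l, bary 1 ((n : ℝ)⁻¹ • ∑ i, t i) l = (n : ℝ)⁻¹ * ∑ i, bary 1 (t i) l := by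
    intro l
    refine Fin.cases ?_ (fun l => ?_) l
    · simp only [bary_zero, Pi.smul_apply, Finset.sum_apply, smul_eq_mul, Finset.sum_sub_distrib,
        ← Finset.mul_sum]
      rw [Finset.sum_comm, mul_sub]
      simp [hn']
    · simp
  simp only [h]
  rw [Finset.sum_comm, Finset.sum_div]
  refine Finset.sum_congr rfl fun l _ => ?_
  rw [← Finset.sum_mul]
  field_simp

/-- The deficit must be nonnegative, but `f` may exceed the interpolation inside the cell;
truncating `f` there to the minimum only lowers the averages. -/
theorem simplex_lower_bound {k n : ℕ} (hk : 1 ≤ k) (hk3 : k ≤ 3) (hn : 1 ≤ n)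
    {v : Fin (k + 1) → Space k} (hv : UniqueBary v) {η : Fin (k + 1) → ℝ} {f H : Space k → ℝ}
    (hfi : IntegrableOn f (convexHull ℝ (Set.range v)))
    (hHi : IntegrableOn H (convexHull ℝ (Set.range v))) (hη : ∀ i, η i ≤ f (v i))
    (hH : ∀ x : Fin n → Space k, (∀ i, x i ∈ convexHull ℝ (Set.range v)) →
      (∑ i, f (x i)) / n ≤ H ((n : ℝ)⁻¹ • ∑ i, x i)) :
    ∫ x in convexHull ℝ (Set.range v), (sharpConst k n * interpolation v η x +
      (1 - sharpConst k n) * min (f x) (interpolation v η x)) ≤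
      ∫ x in convexHull ℝ (Set.range v), H x := by
  have hLi := integrableOn_interpolation hv η
  have hmi : IntegrableOn (fun x => min (f x) (interpolation v η x))
    (convexHull ℝ (Set.range v)) := hfi.inf hLi
  have hn' : (0 : ℝ) < n := by exact_mod_cast hn
  have key := simplex_inequality hk hk3 hn hv
    (F := fun x => interpolation v η x - min (f x) (interpolation v η x))
    (G := fun x => interpolation v η x - H x)
    (fun x _ => sub_nonneg.2 (min_le_right _ _)) (hLi.sub hmi)
    (fun i => by rw [interpolation_vertex hv, min_eq_right (hη i), sub_self]) (hLi.sub hHi)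
    (fun x hx => by
      rw [interpolation_average hn hv η hx, Finset.sum_sub_distrib, sub_div]
      refine sub_le_sub_left (le_trans ?_ (hH x hx)) _
      gcongr with i
      exact min_le_left _ _)
  rw [integral_sub hLi hHi, integral_sub hLi hmi] at key
  rw [integral_add (hLi.const_mul _) (hmi.const_mul _), integral_const_mul, integral_const_mul]
  linarith

theorem exists_weights_of_mem_graphHull {k : ℕ} {P : Finset (Space k)} {f : Space k → ℝ}
    {z : Space k}
    {t : ℝ} (h : (z, t) ∈ graphHull (P : Set (Space k)) f) :
    ∃ u ∈ stdSimplex ℝ P, ∑ i, u i • (i : Space k) = z ∧ ∑ i, u i * f i = t := by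
  have hsub : graphHull (P : Set (Space k)) f ⊆
      (Fintype.linearCombination ℝ fun i : P => ((i : Space k), f i)) '' stdSimplex ℝ P := by
    refine convexHull_min ?_ ((convex_stdSimplex ℝ P).linear_image _)
    rintro _ ⟨x, hx, rfl⟩
    classical
    exact ⟨Pi.single ⟨x, hx⟩ 1, single_mem_stdSimplex ℝ _,
      by simp [Fintype.linearCombination_apply_single]⟩
  obtain ⟨u, hu, huz⟩ := hsub h
  rw [Fintype.linearCombination_apply] at huz
  refine ⟨u, hu, ?_, ?_⟩
  · simpa [Prod.fst_sum] using congrArg Prod.fst huz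
  · simpa [Prod.snd_sum] using congrArg Prod.snd huz

open Classical in
/-- The envelope of `f` on finitely many points, extended by a constant. -/
noncomputable def extendedEnvelope {k : ℕ} (P : Finset (Space k)) (f : Space k → ℝ) (M : ℝ)
    (z : Space k) : ℝ :=
  if z ∈ convexHull ℝ (P : Set (Space k)) then envelope (P : Set (Space k)) f z else -M

theorem measurableSet_convexHull_finset {k : ℕ} (P : Finset (Space k)) :
    MeasurableSet (convexHull ℝ (P : Set (Space k))) :=
  (P.finite_toSet.isCompact_convexHull ℝ).isClosed.measurableSet

section domain

variable {k n : ℕ} {C : Set (Space k)} {f H : Space k → ℝ} {M : ℝ}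

theorem aestronglyMeasurable_extendedEnvelope {P : Finset (Space k)}
    (hf : ∀ x ∈ (P : Set (Space k)), |f x| ≤ M) (μ : Measure (Space k)) (hμ : μ ≤ volume) :
    AEStronglyMeasurable (extendedEnvelope P f M) μ := by
  classical
  have h1 : AEStronglyMeasurable (envelope (P : Set (Space k)) f)
      (μ.restrict (convexHull ℝ (P : Set (Space k)))) :=
    (aestronglyMeasurable_of_concaveOn (concaveOn_envelope hf)).mono_measure
      (Measure.restrict_mono le_rfl hμ)
  have h2 := AEStronglyMeasurable.piecewise (measurableSet_convexHull_finset P) h1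
    (aestronglyMeasurable_const (b := -M))
  convert h2 using 1
  funext z
  simp [extendedEnvelope, Set.piecewise]

theorem abs_extendedEnvelope_le {P : Finset (Space k)} (hf : ∀ x ∈ (P : Set (Space k)), |f x| ≤ M)
    (hM : 0 ≤ M) (z : Space k) : |extendedEnvelope P f M z| ≤ M := by
  unfold extendedEnvelope
  split_ifs with h
  · exact abs_envelope_le hf h
  · rw [abs_neg, abs_of_nonneg hM]

theorem integrableOn_envelope (hC : IsCompact C) (hCc : Convex ℝ C) (hf : ∀ x ∈ C, |f x| ≤ M) :
    IntegrableOn (envelope C f) C := by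
  have hm := aestronglyMeasurable_of_concaveOn (concaveOn_envelope hf)
  rw [hCc.convexHull_eq] at hm
  refine IntegrableOn.of_bound hC.measure_lt_top hm M ?_
  filter_upwards [ae_restrict_mem hC.isClosed.measurableSet] with z hz
  exact abs_envelope_le hf (subset_convexHull ℝ C hz)

/-- The integrand on the left is below the bound of `simplex_lower_bound` on every cell. Outside the
hull of `P` it is below `f`, hence below `H`. The cells cover the hull almost everywhere with null
overlaps, so the local inequalities add up. -/
theorem approximate_lower_bound (hk : 1 ≤ k) (hk3 : k ≤ 3) (hn : 1 ≤ n) (hC : IsCompact C)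
    (hCc : Convex ℝ C) (hM : 0 ≤ M) (hf : ∀ x ∈ C, |f x| ≤ M) (hfi : IntegrableOn f C)
    (hHi : IntegrableOn H C)
    (hH : ∀ x : Fin n → Space k, (∀ i, x i ∈ C) → (∑ i, f (x i)) / n ≤ H ((n : ℝ)⁻¹ • ∑ i, x i))
    {P : Finset (Space k)} (hP : (P : Set (Space k)) ⊆ C) {ε : ℝ} (hε : 0 < ε) :
    ∫ z in C, (sharpConst k n * (extendedEnvelope P f M z - ε) + (1 - sharpConst k n) *
      (f z - envelope C f z + (extendedEnvelope P f M z - ε))) ≤ ∫ z in C, H z := by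
  obtain ⟨hc0, hc1⟩ := sharpConst_mem_Icc hk hk3 hn
  set c := sharpConst k n with hc
  set φ := extendedEnvelope P f M with hφ
  have hn' : (n : ℝ) ≠ 0 := by positivity
  have hfP : ∀ x ∈ (P : Set (Space k)), |f x| ≤ M := fun x hx => hf x (hP hx)
  have hCm : MeasurableSet C := hC.isClosed.measurableSet
  have hCfin : volume C ≠ ⊤ := hC.measure_lt_top.ne
  have hφi : IntegrableOn φ C := Measure.integrableOn_of_bounded hCfin
    (aestronglyMeasurable_extendedEnvelope hfP volume le_rfl)
    (M := M) (Filter.Eventually.of_forall fun z => abs_extendedEnvelope_le hfP hM z)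
  have hei := integrableOn_envelope hC hCc hf
  set Θ : Space k → ℝ := fun z => c * (φ z - ε) + (1 - c) * (f z - envelope C f z + (φ z - ε))
    with hΘ
  have hφε : IntegrableOn (fun z => φ z - ε) C := hφi.sub (integrableOn_const hCfin)
  have hΘi : IntegrableOn Θ C := (hφε.const_mul c).add (((hfi.sub hei).add hφε).const_mul (1 - c))
  have hDi : IntegrableOn (fun z => Θ z - H z) C := hΘi.sub hHi
  have hself : ∀ z ∈ C, f z ≤ H z := fun z hz => by
    have := hH (fun _ => z) fun _ => hz
    simp only [Finset.sum_const, Finset.card_univ, Fintype.card_fin, nsmul_eq_mul] at this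
    rw [mul_div_cancel_left₀ _ hn', ← Nat.cast_smul_eq_nsmul ℝ, smul_smul, inv_mul_cancel₀ hn',
      one_smul] at this
    exact this
  suffices ∫ z in C, (Θ z - H z) ≤ 0 by
    rw [integral_sub hΘi hHi] at this
    linarith
  obtain ⟨h, N, hh, hNv, hNle, hNd, hNc⟩ :=
    exists_triangulation (fun i : P => (i : Space k)) (fun i => f i) hε
  set σ : (Fin (k + 1) → P) → Set (Space k) :=
    fun e => convexHull ℝ (Set.range ((fun i : P => (i : Space k)) ∘ e)) with hσ
  have hrange : Set.range (fun i : P => (i : Space k)) = P := by ext x; simp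
  have hσP : ∀ e, σ e ⊆ convexHull ℝ (P : Set (Space k)) := fun e => convexHull_mono
    (by rintro _ ⟨a, rfl⟩; exact (e a).2)
  have hPC : convexHull ℝ (P : Set (Space k)) ⊆ C := convexHull_min hP hCc
  have hσC : ∀ e, σ e ⊆ C := fun e => (hσP e).trans hPC
  have hσm : ∀ e, MeasurableSet (σ e) := fun e =>
    ((Set.finite_range _).isCompact_convexHull ℝ).isClosed.measurableSet
  have hpiece : ∀ e ∈ N, ∫ z in σ e, (Θ z - H z) ≤ 0 := by
    intro e he
    have hv := hNv e he
    have hlow := simplex_lower_bound hk hk3 hn hv (η := h ∘ e) (hfi.mono_set (hσC e))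
      (hHi.mono_set (hσC e)) (fun i => (hh (e i)).1) fun x hx => hH x fun i => hσC e (hx i)
    rw [integral_sub (hΘi.mono_set (hσC e)) (hHi.mono_set (hσC e)), sub_nonpos]
    refine le_trans ?_ hlow
    have hLi := integrableOn_interpolation hv (h ∘ e)
    refine setIntegral_mono_on (hΘi.mono_set (hσC e)) ((hLi.const_mul c).add
      (((hfi.mono_set (hσC e)).inf hLi).const_mul (1 - c))) (hσm e) fun z hz => ?_
    have hzP := hσP e hz
    have hφz : φ z = envelope (P : Set (Space k)) f z := if_pos hzP
    have h1 : φ z ≤ envelope C f z := by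
      rw [hφz]
      exact envelope_mono hf hP hzP
    -- Any weights over `z` lift at most to the interpolated height of the cell, and the heights are
    -- within `ε` of `f`.
    have h2 : φ z - ε ≤ interpolation ((fun i : P => (i : Space k)) ∘ e) (h ∘ e) z := by
      rw [hφz, sub_le_iff_le_add]
      refine envelope_le hzP fun t ht => ?_
      obtain ⟨u, hu, huz, hut⟩ := exists_weights_of_mem_graphHull ht
      have hz' := hz
      change z ∈ convexHull ℝ (Set.range ((fun i : P => (i : Space k)) ∘ e)) at hz'
      rw [← image_chart] at hz'
      obtain ⟨s, hs, rfl⟩ := hz'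
      rw [interpolation_chart hv]
      have h3 := hNle e he s hs u hu huz
      have h4 : ∑ i, u i * f i ≤ ∑ i, (u i * h i + u i * ε) := by
        refine Finset.sum_le_sum fun i _ => ?_
        rw [← mul_add]
        exact mul_le_mul_of_nonneg_left (by linarith [(hh i).2]) (hu.1 i)
      rw [Finset.sum_add_distrib, ← Finset.sum_mul, hu.2, one_mul, hut] at h4
      exact h4.trans (add_le_add_left h3 ε)
    have h3 := self_le_envelope hf (hσC e hz)
    -- The first bound uses that the envelope over `P` is at most that over `C`, the second that `f`
    -- is at most its envelope.
    have h4 : f z - envelope C f z + (φ z - ε) ≤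
        min (f z) (interpolation ((fun i : P => (i : Space k)) ∘ e) (h ∘ e) z) :=
      le_min (by linarith) (by linarith)
    exact add_le_add (mul_le_mul_of_nonneg_left h2 hc0)
      (mul_le_mul_of_nonneg_left h4 (by linarith))
  set U : Set (Space k) := ⋃ e : N, σ e with hU
  have hUm : MeasurableSet U := MeasurableSet.iUnion fun e => hσm e
  have hUC : U ⊆ C := Set.iUnion_subset fun e => hσC e
  have hUint : ∫ z in U, (Θ z - H z) ≤ 0 := by
    rw [hU, integral_iUnion_ae (fun e : N => (hσm e).nullMeasurableSet)
      (fun e e' hne => hNd e.2 e'.2 fun h => hne (Subtype.ext h)) (hDi.mono_set hUC), tsum_fintype]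
    exact Finset.sum_nonpos fun e _ => hpiece e e.2
  have hrest : ∫ z in C \ U, (Θ z - H z) ≤ 0 := by
    refine integral_nonpos_of_ae ?_
    rw [hrange] at hNc
    filter_upwards [ae_restrict_mem (hCm.diff hUm), ae_restrict_of_ae hNc] with z hz hz2
    have hzP : z ∉ convexHull ℝ (P : Set (Space k)) := fun hzP => hz.2 (by
      obtain ⟨e, he, hze⟩ := Set.mem_iUnion₂.1 (hz2 hzP)
      exact Set.mem_iUnion.2 ⟨⟨e, he⟩, hze⟩)
    have hφz : φ z = -M := if_neg hzP
    have h1 := self_le_envelope hf hz.1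
    have h2 := (abs_le.1 (hf z hz.1)).1
    -- The value `-M` is at most `f z`, and `f z - envelope C f z ≤ 0`; so both bracketed terms are
    -- at most `f z ≤ H z`.
    have h3 := hself z hz.1
    have h4 : c * (φ z - ε) + (1 - c) * (f z - envelope C f z + (φ z - ε)) ≤
        c * f z + (1 - c) * f z :=
      add_le_add (mul_le_mul_of_nonneg_left (by linarith) hc0)
        (mul_le_mul_of_nonneg_left (by linarith) (by linarith))
    simp only [hΘ, Pi.zero_apply]
    linarith
  rw [← Set.union_sdiff_cancel hUC, setIntegral_union Set.disjoint_sdiff_right (hCm.diff hUm)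
    (hDi.mono_set hUC) (hDi.mono_set Set.sdiff_subset)]
  linarith

end domain

/-! ### Passage to the limit and to upper integrals -/

section domain

variable {k n : ℕ} {C : Set (Space k)} {f H : Space k → ℝ} {M : ℝ}

theorem integral_lower_bound (hk : 1 ≤ k) (hk3 : k ≤ 3) (hn : 1 ≤ n) (hC : IsCompact C)
    (hCc : Convex ℝ C) (hM : 0 ≤ M) (hf : ∀ x ∈ C, |f x| ≤ M) (hfi : IntegrableOn f C)
    (hHi : IntegrableOn H C)
    (hH : ∀ x : Fin n → Space k, (∀ i, x i ∈ C) →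
      (∑ i, f (x i)) / n ≤ H ((n : ℝ)⁻¹ • ∑ i, x i)) :
    sharpConst k n * (∫ z in C, envelope C f z) + (1 - sharpConst k n) * (∫ z in C, f z) ≤
      ∫ z in C, H z := by
  obtain ⟨hc0, hc1⟩ := sharpConst_mem_Icc hk hk3 hn
  have hCm : MeasurableSet C := hC.isClosed.measurableSet
  have hei := integrableOn_envelope hC hCc hf
  obtain ⟨P, hPC, hP⟩ := exists_finset_approximation hCc hf
  have hε : ∀ m : ℕ, (0 : ℝ) < 1 / ((m : ℝ) + 1) := fun m => by positivity
  have hε1 : ∀ m : ℕ, (1 : ℝ) / ((m : ℝ) + 1) ≤ 1 := fun m => by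
    rw [div_le_one (by positivity)]
    linarith [(Nat.cast_nonneg m : (0 : ℝ) ≤ m)]
  have hbound := fun m => approximate_lower_bound hk hk3 hn hC hCc hM hf hfi hHi hH (hPC m) (hε m)
  have hfP : ∀ m, ∀ x ∈ (P m : Set (Space k)), |f x| ≤ M := fun m x hx => hf x (hPC m hx)
  have hlim : Filter.Tendsto (fun m => ∫ z in C,
      (sharpConst k n * (extendedEnvelope (P m) f M z - 1 / ((m : ℝ) + 1)) + (1 - sharpConst k n) *
        (f z - envelope C f z + (extendedEnvelope (P m) f M z - 1 / ((m : ℝ) + 1)))))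
      Filter.atTop (𝓝 (∫ z in C, (sharpConst k n * envelope C f z + (1 - sharpConst k n) * f z)))
        := by
    -- Each bracket combines at most three functions bounded by `M` and an error at most `1`, with a
    -- coefficient in `[0, 1]`.
    refine tendsto_integral_of_dominated_convergence (fun _ => 3 * M + 1 + (3 * M + 1)) ?_
      (integrableOn_const hC.measure_lt_top.ne) ?_ ?_
    · intro m
      have h1 := aestronglyMeasurable_extendedEnvelope (hfP m) (volume.restrict C)
        Measure.restrict_le_self
      have h2 := h1.sub (aestronglyMeasurable_const (b := 1 / ((m : ℝ) + 1)))
      exact (h2.const_mul _).add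
        (((hfi.aestronglyMeasurable.sub hei.aestronglyMeasurable).add h2).const_mul _)
    · intro m
      filter_upwards [ae_restrict_mem hCm] with z hz
      have h1 := abs_le.1 (abs_extendedEnvelope_le (hfP m) hM z)
      have h2 := abs_le.1 (hf z hz)
      have h3 := abs_le.1 (abs_envelope_le hf (subset_convexHull ℝ C hz))
      have h4 := hε m
      have h5 := hε1 m
      rw [Real.norm_eq_abs]
      refine (abs_add_le _ _).trans (add_le_add ?_ ?_)
      · rw [abs_mul, abs_of_nonneg hc0]
        refine (mul_le_of_le_one_left (abs_nonneg _) hc1).trans (abs_le.2 ⟨?_, ?_⟩) <;> linarith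
      · rw [abs_mul, abs_of_nonneg (sub_nonneg.2 hc1)]
        refine (mul_le_of_le_one_left (abs_nonneg _) (by linarith)).trans (abs_le.2 ⟨?_, ?_⟩) <;>
          linarith
    · rw [← Measure.restrict_congr_set (interior_ae_eq_of_convex hCc)]
      filter_upwards [ae_restrict_mem isOpen_interior.measurableSet] with z hz
      obtain ⟨h1, h2⟩ := hP z hz
      have h3 : Filter.Tendsto (fun m => extendedEnvelope (P m) f M z) Filter.atTop
          (𝓝 (envelope C f z)) :=
        h2.congr' (h1.mono fun m hm => (if_pos hm).symm)
      have h4 := h3.sub (tendsto_one_div_add_atTop_nhds_zero_nat (𝕜 := ℝ))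
      have h5 := (h4.const_mul (sharpConst k n)).add
        ((h4.const_add (f z - envelope C f z)).const_mul (1 - sharpConst k n))
      convert h5 using 2
      ring
  have h := le_of_tendsto' hlim hbound
  rwa [integral_add (hei.const_mul _) (hfi.const_mul _), integral_const_mul,
    integral_const_mul] at h

theorem bddAbove_supConv (hn : 1 ≤ n) (hf : ∀ x ∈ C, |f x| ≤ M) (z : Space k) :
    BddAbove {y : ℝ | ∃ x : Fin n → Space k, (∀ i, x i ∈ C) ∧
      (n : ℝ)⁻¹ • ∑ i, x i = z ∧ y = (∑ i, f (x i)) / n} := by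
  have hn' : (0 : ℝ) < n := by exact_mod_cast hn
  refine ⟨M, ?_⟩
  rintro _ ⟨x, hx, -, rfl⟩
  rw [div_le_iff₀ hn']
  refine (Finset.sum_le_sum fun i _ => (abs_le.1 (hf (x i) (hx i))).2).trans ?_
  simp [mul_comm]

theorem average_le_supConvPow (hn : 1 ≤ n) (hf : ∀ x ∈ C, |f x| ≤ M) {x : Fin n → Space k}
    (hx : ∀ i, x i ∈ C) :
    (∑ i, f (x i)) / n ≤ supConvPow C n f ((n : ℝ)⁻¹ • ∑ i, x i) :=
  le_csSup (bddAbove_supConv hn hf _) ⟨x, hx, rfl, rfl⟩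

theorem self_le_supConvPow (hn : 1 ≤ n) (hf : ∀ x ∈ C, |f x| ≤ M) {z : Space k} (hz : z ∈ C) :
    f z ≤ supConvPow C n f z := by
  have hn' : (n : ℝ) ≠ 0 := by positivity
  have h := average_le_supConvPow hn hf (x := fun _ => z) fun _ => hz
  simpa [← Nat.cast_smul_eq_nsmul ℝ, smul_smul, hn'] using h

theorem supConvPow_le (hn : 1 ≤ n) {z : Space k} (hz : z ∈ C) {b : ℝ}
    (h : ∀ x : Fin n → Space k, (∀ i, x i ∈ C) → (n : ℝ)⁻¹ • ∑ i, x i = z →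
      (∑ i, f (x i)) / n ≤ b) : supConvPow C n f z ≤ b := by
  have hn' : (n : ℝ) ≠ 0 := by positivity
  refine csSup_le ⟨_, fun _ => z, fun _ => hz, ?_, rfl⟩ ?_
  · simp [← Nat.cast_smul_eq_nsmul ℝ, smul_smul, hn']
  · rintro _ ⟨x, hx, hxz, rfl⟩
    exact h x hx hxz

/-- One integrable majorant must be exhibited, since the infimum of the empty set is `0` by
convention. -/
theorem le_integral_of_le {g h : Space k → ℝ} {I : ℝ} (hI : ∀ h : Space k → ℝ, IntegrableOn h C →
      (∀ x ∈ C, g x ≤ h x) → I ≤ ∫ x in C, h x) (hh : IntegrableOn h C) (hgh : ∀ x ∈ C, g x ≤ h x) :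
    I ≤ upperIntegral C g :=
  le_csInf ⟨_, h, hh, hgh, rfl⟩ (by rintro _ ⟨h, h1, h2, rfl⟩; exact hI h h1 h2)

theorem upperIntegral_le {g h : Space k → ℝ} (hC : MeasurableSet C) (hg : ∀ x ∈ C, 0 ≤ g x)
    (hh : IntegrableOn h C) (hgh : ∀ x ∈ C, g x ≤ h x) :
    upperIntegral C g ≤ ∫ x in C, h x := by
  refine csInf_le ⟨0, ?_⟩ ⟨h, hh, hgh, rfl⟩
  rintro _ ⟨h, -, h2, rfl⟩
  exact setIntegral_nonneg hC fun x hx => (hg x hx).trans (h2 x hx)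

theorem integrableOn_of_abs_le (hC : IsCompact C) (hf : ∀ x ∈ C, |f x| ≤ M)
    (hfm : AEMeasurable f (volume.restrict C)) : IntegrableOn f C := by
  refine IntegrableOn.of_bound hC.measure_lt_top hfm.aestronglyMeasurable M ?_
  filter_upwards [ae_restrict_mem hC.isClosed.measurableSet] with z hz
  exact hf z hz

theorem upperIntegral_supConvPow_ge (hk : 1 ≤ k) (hk3 : k ≤ 3) (hn : 1 ≤ n) (hC : IsCompact C)
    (hCc : Convex ℝ C) (hf : ∃ M : ℝ, ∀ x ∈ C, |f x| ≤ M)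
    (hfm : AEMeasurable f (volume.restrict C)) :
    sharpConst k n * upperIntegral C (fun x => concaveHull C f x - f x) ≤
      upperIntegral C (fun x => supConvPow C n f x - f x) := by
  obtain ⟨M, hM, hf⟩ : ∃ M : ℝ, 0 ≤ M ∧ ∀ x ∈ C, |f x| ≤ M :=
    hf.elim fun M h => ⟨|M|, abs_nonneg M, fun x hx => (h x hx).trans (le_abs_self M)⟩
  obtain ⟨hc0, hc1⟩ := sharpConst_mem_Icc hk hk3 hn
  have hCm : MeasurableSet C := hC.isClosed.measurableSet
  have hfi := integrableOn_of_abs_le hC hf hfm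
  have hei := integrableOn_envelope hC hCc hf
  have hhull : ∀ x ∈ C, concaveHull C f x - f x = envelope C f x - f x := fun x hx => by
    rw [concaveHull_eq_envelope hCc hf hx]
  have h1 : upperIntegral C (fun x => concaveHull C f x - f x) ≤
      ∫ x in C, (envelope C f x - f x) :=
    upperIntegral_le hCm (fun x hx => by
      rw [hhull x hx]
      exact sub_nonneg.2 (self_le_envelope hf hx)) (hei.sub hfi) fun x hx => (hhull x hx).le
  refine (mul_le_mul_of_nonneg_left h1 hc0).trans ?_
  refine le_integral_of_le (h := fun _ => M + M) (fun h hh hle => ?_)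
    (integrableOn_const hC.measure_lt_top.ne) fun x hx => ?_
  -- If `h` dominates the difference, then `h + f` dominates the sup-convolution and is integrable,
  -- so it can play the role of `H`.
  · have h2 := integral_lower_bound hk hk3 hn hC hCc hM hf hfi (hh.add hfi) fun x hx => by
      have h3 := hle ((n : ℝ)⁻¹ • ∑ i, x i) (by
        rw [Finset.smul_sum]
        exact hCc.sum_mem (fun i _ => by positivity)
          (by simp [mul_inv_cancel₀ (show (n : ℝ) ≠ 0 by positivity)]) fun i _ => hx i)
      exact (average_le_supConvPow hn hf hx).trans (sub_le_iff_le_add.1 h3)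
    rw [integral_sub hei hfi]
    have h4 : ∫ x in C, (h + f) x = (∫ x in C, h x) + ∫ x in C, f x := integral_add hh hfi
    rw [h4] at h2
    linarith
  · refine sub_le_iff_le_add.2 ?_
    have h2 : supConvPow C n f x ≤ M := supConvPow_le hn hx fun y hy _ => by
      rw [div_le_iff₀ (by exact_mod_cast hn)]
      refine (Finset.sum_le_sum fun i _ => (abs_le.1 (hf (y i) (hy i))).2).trans ?_
      simp [mul_comm]
    linarith [(abs_le.1 (hf x hx)).1]

end domain

/-! ### Sharpness -/

/-- An upper bound at `n⁻¹ • u` for the sup-convolution of the indicator of the vertices of the solid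
simplex. -/
noncomputable def vertexAverage {k : ℕ} (n : ℕ) (u : Fin k → ℝ) : ℝ :=
  ((n : ℝ) - ⌈∑ i, Int.fract (u i)⌉₊) / n

theorem measurable_vertexAverage {k : ℕ} (n : ℕ) : Measurable (vertexAverage (k := k) n) := by
  have h1 : Measurable fun u : Fin k → ℝ => ∑ i, Int.fract (u i) :=
    Finset.measurable_sum _ fun i _ => measurable_fract.comp (measurable_pi_apply i)
  have h2 : Measurable fun u : Fin k → ℝ => ((⌈∑ i, Int.fract (u i)⌉₊ : ℕ) : ℝ) :=
    (measurable_from_nat (f := fun m : ℕ => (m : ℝ))).comp (Nat.measurable_ceil.comp h1)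
  exact (h2.const_sub _).div_const _

theorem abs_vertexAverage_le {k : ℕ} (n : ℕ) (u : Fin k → ℝ) :
    |vertexAverage n u| ≤ (n + k) / n := by
  have h : ((⌈∑ i, Int.fract (u i)⌉₊ : ℕ) : ℝ) ≤ k := by exact_mod_cast (exists_mem_slab u).2
  rw [vertexAverage, abs_div, Nat.abs_cast]
  gcongr
  rw [abs_le]
  constructor <;> linarith [(Nat.cast_nonneg n : (0 : ℝ) ≤ n),
    (Nat.cast_nonneg ⌈∑ i, Int.fract (u i)⌉₊ : (0 : ℝ) ≤ _)]

theorem integrableOn_vertexAverage (k n : ℕ) :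
    IntegrableOn (vertexAverage (k := k) n) (solidSimplex k n) :=
  Measure.integrableOn_of_bounded (isCompact_solidSimplex k n).measure_lt_top.ne
    (measurable_vertexAverage n).aestronglyMeasurable
    (Filter.Eventually.of_forall fun u => abs_vertexAverage_le n u)

theorem setIntegral_vertexAverage {k n : ℕ} (hk : 1 ≤ k) (hk3 : k ≤ 3) (hn : 1 ≤ n) :
    ∫ u in solidSimplex k n, vertexAverage n u =
      (n : ℝ) ^ k * (sharpConst k n * volume.real (solidSimplex k 1)) := by
  rw [setIntegral_solidSimplex_eq_sum_Icc hk n (integrableOn_vertexAverage k n),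
    ← sum_card_corners_volume hk hk3 hn]
  refine Finset.sum_congr rfl fun j _ => ?_
  rw [← nsmul_eq_mul, ← Finset.sum_const]
  refine Finset.sum_congr rfl fun m _ => ?_
  rw [setIntegral_congr_fun (g := fun _ => ((n : ℝ) - j) / n) (measurableSet_slab k j)
    fun r hr => ?_]
  · simp
  · have h := (eq_floor_of_sub_mem_slab (t := natVec m + r) (m := m) (j := j) (by simpa using hr)).2
    simp only [vertexAverage]
    rw [← h]

/-- Points with integer coordinates do not affect fractional parts. The fractional sum is therefore
at most the sum of all coordinates of the other points, each of which contributes at most `1`. -/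
theorem card_le_vertexAverage {k n : ℕ} {s : Fin n → Fin k → ℝ}
    (hs : ∀ i, s i ∈ solidSimplex k 1) (V : Finset (Fin n))
    (hV : ∀ i ∈ V, ∀ l, ∃ z : ℤ, s i l = z) :
    (V.card : ℝ) / n ≤ vertexAverage n (∑ i, s i) := by
  classical
  have h1 : ∀ l, Int.fract ((∑ i, s i) l) ≤ ∑ i ∈ Vᶜ, s i l := by
    intro l
    have h2 : ∃ z : ℤ, ∑ i ∈ V, s i l = z := by
      choose! z hz using fun i hi => hV i hi l
      exact ⟨∑ i ∈ V, z i, by rw [Int.cast_sum]; exact Finset.sum_congr rfl hz⟩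
    obtain ⟨z, hz⟩ := h2
    have h0 : 0 ≤ ∑ i ∈ Vᶜ, s i l := Finset.sum_nonneg fun i _ => (hs i).1 l
    rw [Finset.sum_apply, ← Finset.sum_add_sum_compl V, hz, Int.fract_intCast_add, Int.fract]
    have : (0 : ℝ) ≤ ⌊∑ i ∈ Vᶜ, s i l⌋ := by exact_mod_cast Int.floor_nonneg.2 h0
    linarith
  have h2 : ∑ l, Int.fract ((∑ i, s i) l) ≤ (Vᶜ.card : ℕ) := by
    refine (Finset.sum_le_sum fun l _ => h1 l).trans ?_
    rw [Finset.sum_comm]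
    refine (Finset.sum_le_sum fun i _ => (hs i).2).trans ?_
    simp
  have h3 : ((⌈∑ l, Int.fract ((∑ i, s i) l)⌉₊ : ℕ) : ℝ) ≤ Vᶜ.card := by
    exact_mod_cast Nat.ceil_le.2 h2
  have h4 : (V.card : ℝ) + Vᶜ.card = n := by
    exact_mod_cast (Finset.card_add_card_compl V).trans (Fintype.card_fin n)
  rw [vertexAverage]
  gcongr
  linarith

theorem uniqueBary_of_affineIndependent {k : ℕ} {v : Fin (k + 1) → Space k}
    (hv : AffineIndependent ℝ v) : UniqueBary v := by
  intro w h0 h1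
  funext i
  refine (affineIndependent_iff_of_fintype ℝ v).1 hv w h0 ?_ i
  rwa [Finset.univ.weightedVSub_eq_linear_combination h0]

theorem exists_int_of_chart_mem_range {k : ℕ} {v : Fin (k + 1) → Space k} (hv : UniqueBary v)
    {t : Fin k → ℝ} (ht : chart v t ∈ Set.range v) (l : Fin k) : ∃ z : ℤ, t l = z := by
  obtain ⟨i, hi⟩ := ht
  have h : bary 1 (fun l : Fin k => (Pi.single i 1 : Fin (k + 1) → ℝ) l.succ) = Pi.single i 1 :=
    bary_tail (by simp)
  have h2 : chart v (fun l : Fin k => (Pi.single i 1 : Fin (k + 1) → ℝ) l.succ) = v i := by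
    rw [chart, h]
    simp [Pi.single_apply]
  rw [← chart_injective hv (h2.trans hi)]
  by_cases h3 : l.succ = i
  · exact ⟨1, by subst h3; simp⟩
  · exact ⟨0, by simp [h3]⟩

section simplex

variable {k n : ℕ} {v : Fin (k + 1) → Space k}

theorem supConvPow_indicator_le (hn : 1 ≤ n) (hv : UniqueBary v) {z : Space k}
    (hz : z ∈ convexHull ℝ (Set.range v)) :
    supConvPow (convexHull ℝ (Set.range v)) n
      (Set.indicator (Set.range v) fun _ => (1 : ℝ)) z ≤
      vertexAverage n ((n : ℝ) • Function.invFun (chart v) z) := by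
  classical
  have hn' : (n : ℝ) ≠ 0 := by positivity
  refine supConvPow_le hn hz fun x hx hxz => ?_
  have hx' : ∀ i, ∃ t ∈ solidSimplex k 1, chart v t = x i := fun i => by
    have := hx i
    rwa [← image_chart] at this
  choose s hs hsx using hx'
  rw [← hxz, ← funext hsx, ← chart_average hn, Function.leftInverse_invFun (chart_injective hv),
    smul_smul, mul_inv_cancel₀ hn', one_smul]
  refine le_of_eq_of_le ?_ (card_le_vertexAverage hs
    (Finset.univ.filter fun i => chart v (s i) ∈ Set.range v) fun i hi l =>
      exists_int_of_chart_mem_range hv (Finset.mem_filter.1 hi).2 l)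
  simp [Set.indicator_apply]

theorem indicator_range_ae_eq_zero (hk : 1 ≤ k) :
    Set.indicator (Set.range v) (fun _ => (1 : ℝ)) =ᵐ[volume] 0 := by
  have : Nonempty (Fin k) := ⟨⟨0, hk⟩⟩
  exact indicator_meas_zero ((Set.finite_range v).measure_zero _)

theorem abs_indicator_le (x : Space k) :
    |Set.indicator (Set.range v) (fun _ => (1 : ℝ)) x| ≤ 1 := by
  by_cases h : x ∈ Set.range v <;> simp [h]

theorem isCompact_convexHull_range : IsCompact (convexHull ℝ (Set.range v)) :=
  (Set.finite_range v).isCompact_convexHull ℝ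

theorem upperIntegral_supConvPow_indicator_le (hk : 1 ≤ k) (hk3 : k ≤ 3) (hn : 1 ≤ n)
    (hv : UniqueBary v) :
    upperIntegral (convexHull ℝ (Set.range v)) (fun x =>
      supConvPow (convexHull ℝ (Set.range v)) n (Set.indicator (Set.range v) fun _ => (1 : ℝ)) x -
        Set.indicator (Set.range v) (fun _ => (1 : ℝ)) x) ≤
      sharpConst k n * volume.real (convexHull ℝ (Set.range v)) := by
  set T := convexHull ℝ (Set.range v) with hT
  have hn' : (n : ℝ) ≠ 0 := by positivity
  have hTc : IsCompact T := isCompact_convexHull_range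
  have hφ : ∀ t, vertexAverage n ((n : ℝ) • Function.invFun (chart v) (chart v t)) =
      vertexAverage n ((n : ℝ) • t) := fun t => by
    rw [Function.leftInverse_invFun (chart_injective hv)]
  have hscale : ∫ t in solidSimplex k 1, vertexAverage n ((n : ℝ) • t) =
      sharpConst k n * volume.real (solidSimplex k 1) := by
    have h1 := setIntegral_smul_solidSimplex hn fun t : Fin k → ℝ => vertexAverage n ((n : ℝ) • t)
    simp only [smul_smul, mul_inv_cancel₀ hn', one_smul] at h1
    rw [setIntegral_vertexAverage hk hk3 hn] at h1
    exact (mul_left_cancel₀ (pow_ne_zero k hn') h1).symm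
  have hint : IntegrableOn (fun z => vertexAverage n ((n : ℝ) • Function.invFun (chart v) z))
    T := by
    rw [hT, integrableOn_chart_iff hv]
    simp only [hφ]
    refine IntegrableOn.of_bound (isCompact_solidSimplex k 1).measure_lt_top ?_ ((n + k) / n)
      (Filter.Eventually.of_forall fun t => abs_vertexAverage_le n _)
    exact ((measurable_vertexAverage n).comp (measurable_const_smul (n : ℝ))).aestronglyMeasurable
  have hzero := indicator_range_ae_eq_zero (v := v) hk
  have hfi : IntegrableOn (Set.indicator (Set.range v) fun _ => (1 : ℝ)) T :=
    (integrable_zero _ _ _).congr (ae_restrict_of_ae hzero.symm)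
  have hself : ∀ z ∈ T, Set.indicator (Set.range v) (fun _ => (1 : ℝ)) z ≤
      supConvPow T n (Set.indicator (Set.range v) fun _ => (1 : ℝ)) z := fun z hz =>
    self_le_supConvPow hn (fun x _ => abs_indicator_le x) hz
  refine (upperIntegral_le hTc.isClosed.measurableSet (fun z hz => sub_nonneg.2 (hself z hz))
    (hint.sub hfi) fun z hz => sub_le_sub_right (supConvPow_indicator_le hn hv hz) _).trans_eq ?_
  simp only [Pi.sub_apply]
  rw [integral_sub hint hfi, integral_congr_ae (ae_restrict_of_ae hzero)]
  obtain ⟨c, -, hc⟩ := exists_setIntegral_chart hv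
  have h1 := hc fun _ => 1
  simp only [setIntegral_const, smul_eq_mul, mul_one] at h1
  rw [hT, hc, h1]
  simp only [hφ, hscale, Pi.zero_apply, integral_zero]
  ring

/-- The set where the concave envelope is at least `1` is convex and contains the vertices, hence is
all of the simplex. -/
theorem concaveHull_indicator {z : Space k} (hz : z ∈ convexHull ℝ (Set.range v)) :
    concaveHull (convexHull ℝ (Set.range v)) (Set.indicator (Set.range v) fun _ => (1 : ℝ)) z =
      1 := by
  set T := convexHull ℝ (Set.range v) with hT
  set f := Set.indicator (Set.range v) fun _ => (1 : ℝ) with hf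
  have hfb : ∀ x ∈ T, |f x| ≤ 1 := fun x _ => abs_indicator_le x
  have hTc : Convex ℝ T := convex_convexHull ℝ _
  rw [concaveHull_eq_envelope hTc hfb hz]
  have hz' : z ∈ convexHull ℝ T := subset_convexHull ℝ _ hz
  refine le_antisymm (abs_le.1 (abs_envelope_le hfb hz')).2 ?_
  have h : T ⊆ {x ∈ convexHull ℝ T | 1 ≤ envelope T f x} := by
    refine convexHull_min ?_ ((concaveOn_envelope hfb).convex_ge 1)
    intro x hx
    have hxT : x ∈ T := subset_convexHull ℝ _ hx
    refine ⟨subset_convexHull ℝ _ hxT, le_trans ?_ (self_le_envelope hfb hxT)⟩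
    rw [hf, Set.indicator_of_mem hx]
  exact (h hz).2

theorem upperIntegral_concaveHull_indicator (hk : 1 ≤ k) :
    upperIntegral (convexHull ℝ (Set.range v)) (fun x =>
      concaveHull (convexHull ℝ (Set.range v)) (Set.indicator (Set.range v) fun _ => (1 : ℝ)) x -
        Set.indicator (Set.range v) (fun _ => (1 : ℝ)) x) =
      volume.real (convexHull ℝ (Set.range v)) := by
  have hTm := (isCompact_convexHull_range (v := v)).isClosed.measurableSet
  have hTfin : volume (convexHull ℝ (Set.range v)) ≠ ⊤ :=
    isCompact_convexHull_range.measure_lt_top.ne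
  have hzero := indicator_range_ae_eq_zero (v := v) hk
  have h1 : IntegrableOn (fun _ : Space k => (1 : ℝ)) (convexHull ℝ (Set.range v)) :=
    integrableOn_const hTfin
  have hle : ∀ x ∈ convexHull ℝ (Set.range v),
      concaveHull (convexHull ℝ (Set.range v)) (Set.indicator (Set.range v) fun _ => (1 : ℝ)) x -
        Set.indicator (Set.range v) (fun _ => (1 : ℝ)) x ≤ 1 := fun x hx => by
    rw [concaveHull_indicator hx, sub_le_self_iff]
    exact Set.indicator_nonneg (fun _ _ => zero_le_one) x
  apply le_antisymm
  · refine (upperIntegral_le hTm (fun x hx => ?_) h1 hle).trans_eq (by simp)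
    rw [concaveHull_indicator hx]
    exact sub_nonneg.2 (abs_le.1 (abs_indicator_le x)).2
  · refine le_integral_of_le (fun h hh hgh => ?_) h1 hle
    -- A majorant of the difference is at least `1` away from the vertices, which form a null set.
    have h2 : ∫ _ in convexHull ℝ (Set.range v), (1 : ℝ)
      ≤ ∫ x in convexHull ℝ (Set.range v), h x := by
      refine integral_mono_ae h1 hh ?_
      filter_upwards [ae_restrict_mem hTm, ae_restrict_of_ae hzero] with x hx hx0
      have := hgh x hx
      rw [concaveHull_indicator hx, hx0] at this
      simpa using this
    simpa using h2

theorem volume_convexHull_pos (hv : AffineIndependent ℝ v) :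
    0 < volume.real (convexHull ℝ (Set.range v)) := by
  have h : (interior (convexHull ℝ (Set.range v))).Nonempty := by
    rw [interior_convexHull_nonempty_iff_affineSpan_eq_top,
      hv.affineSpan_eq_top_iff_card_eq_finrank_add_one]
    simp
  have hfin : volume (convexHull ℝ (Set.range v)) ≠ ⊤ :=
    isCompact_convexHull_range.measure_lt_top.ne
  exact ENNReal.toReal_pos
    ((isOpen_interior.measure_pos volume h).trans_le (measure_mono interior_subset)).ne' hfin

theorem upperIntegral_supConvPow_indicator (hk : 1 ≤ k) (hk3 : k ≤ 3) (hn : 1 ≤ n)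
    (hv : AffineIndependent ℝ v) :
    upperIntegral (convexHull ℝ (Set.range v)) (fun x =>
      supConvPow (convexHull ℝ (Set.range v)) n (Set.indicator (Set.range v) fun _ => (1 : ℝ)) x -
        Set.indicator (Set.range v) (fun _ => (1 : ℝ)) x) =
      sharpConst k n * upperIntegral (convexHull ℝ (Set.range v)) (fun x =>
        concaveHull (convexHull ℝ (Set.range v)) (Set.indicator (Set.range v) fun _ => (1 : ℝ)) x -
          Set.indicator (Set.range v) (fun _ => (1 : ℝ)) x) ∧
    0 < upperIntegral (convexHull ℝ (Set.range v)) (fun x =>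
      concaveHull (convexHull ℝ (Set.range v)) (Set.indicator (Set.range v) fun _ => (1 : ℝ)) x -
        Set.indicator (Set.range v) (fun _ => (1 : ℝ)) x) := by
  have h := upperIntegral_concaveHull_indicator (v := v) hk
  refine ⟨le_antisymm ?_ ?_, by rw [h]; exact volume_convexHull_pos hv⟩
  · rw [h]
    exact upperIntegral_supConvPow_indicator_le hk hk3 hn (uniqueBary_of_affineIndependent hv)
  · exact upperIntegral_supConvPow_ge hk hk3 hn isCompact_convexHull_range (convex_convexHull ℝ _)
      ⟨1, fun x _ => abs_indicator_le x⟩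
      (measurable_const.indicator (Set.finite_range v).measurableSet).aemeasurable

end simplex

end SupConvolution

theorem theorem1p1 (k n : ℕ) (hk : 1 ≤ k) (hk3 : k ≤ 3) (hn : 1 ≤ n) :
    -- the inequality, for every compact convex domain and every bounded (Lebesgue) measurable `f`
    (∀ (C : Set (SupConvolution.Space k)) (f : SupConvolution.Space k → ℝ),
      IsCompact C → Convex ℝ C →
      (∃ M : ℝ, ∀ x ∈ C, |f x| ≤ M) →
      AEMeasurable f (volume.restrict C) →
      SupConvolution.upperIntegral C (fun x => SupConvolution.supConvPow C n f x - f x) ≥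
        SupConvolution.sharpConst k n *
          SupConvolution.upperIntegral C (fun x => SupConvolution.concaveHull C f x - f x)) ∧
    -- sharpness: equality, with a positive integral on the right, for the indicator function of
    -- the set of vertices of any nondegenerate simplex
    (∀ (S : Affine.Simplex ℝ (SupConvolution.Space k) k)
      (T : Set (SupConvolution.Space k)) (f : SupConvolution.Space k → ℝ),
      T = convexHull ℝ (Set.range S.points) →
      f = Set.indicator (Set.range S.points) (fun _ => (1 : ℝ)) →
      SupConvolution.upperIntegral T (fun x => SupConvolution.supConvPow T n f x - f x) =
        SupConvolution.sharpConst k n *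
          SupConvolution.upperIntegral T (fun x => SupConvolution.concaveHull T f x - f x) ∧
      0 < SupConvolution.upperIntegral T (fun x => SupConvolution.concaveHull T f x - f x)) := by
  refine ⟨fun C f hC hCc hf hfm =>
    SupConvolution.upperIntegral_supConvPow_ge hk hk3 hn hC hCc hf hfm,
    ?_⟩
  rintro S T f rfl rfl
  exact SupConvolution.upperIntegral_supConvPow_indicator hk hk3 hn S.independent
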